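/- Let $G=(V,\to)$ be a finite directed graph with $n$ vertices and $m$ edges (loops allowed, $\to$ a binary relation on $V$), let $D$ be a depth-first forest of $G$, that is, the ordered forest of discovery edges of some depth-first search of $G$, and let $\mathit{lift}$ be a Boolean. Write $x_h$ for a new element ("exit") attached to a vertex $h$, $\mathrm{DFN}$ for the discovery order of $D$; let $B$ be the set of back edges $u\to v$ ($v$ an ancestor of $u$ in $D$, possibly $u$ itself) and $CF$ the set of cross and forward edges (neither back edges nor edges of $D$). The algorithm $\mathrm{ConstructWPO}^{BU}(G,D,\mathit{lift})$ computes a set $X$ of exits, a set $F$ of scheduling constraints and a set $S$ of stabilization constraints as follows. Initially $X=F=S=\emptyset$. It maintains a partition of $V$ by a disjoint-set structure, where $\mathrm{rep}(v)$ is the representative of the class of $v$ and $\mathrm{merge}(v,h)$ unites the classes of $v$ and $h$ and makes $h$ the representative; initially $\mathrm{rep}(v)=\mathrm{exit}[v]=v$. All edges of $CF$ are removed from $\to$, and each $(u,v)\in CF$ is put into $R[a]$, where $a$ is the lowest common ancestor of $u,v$ in $D$ (a virtual root $\bot$ above all trees if $u,v$ lie in different trees). Then $O[v]:=\{(u,v)\in{\to}\setminus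 B\}$ for all $v$. "Restore $h$" means: for each $(u,v)\in R[h]$ add $(u,\mathrm{rep}(v))$ to $\to$ and $(u,v)$ to $O[\mathrm{rep}(v)]$. "Connect $v$" means: add $(\mathrm{exit}[\mathrm{rep}(u)],v')$ to $F$ for each $(u,v')\in O[v]$ and, if $\mathit{lift}$ is true, also $(\mathrm{exit}[\mathrm{rep}(u)],v)$ for each $(u,v)\in{\to}\setminus B$. For each $h\in V$ in descending $\mathrm{DFN}$: 1. restore $h$; 2. let $P_h=\{\mathrm{rep}(p):(p,h)\in B\}$, $N_h=\emptyset$, $W_h=P_h\setminus\{h\}$; while $W_h\neq\emptyset$, move some $v$ from $W_h$ to $N_h$, and for each $(p,v)\in{\to}\setminus B$ with $\mathrm{rep}(p)\notin N_h\cup\{h\}\cup W_h$ add $\mathrm{rep}(p)$ to $W_h$; 3. if $P_h\ne\emptyset$: connect every $v\in N_h$; add $x_h$ to $X$, $(\mathrm{exit}[\mathrm{rep}(p)],x_h)$ to $F$ for all $p\in P_h$, and $(x_h,h)$ to $S$; set $\mathrm{exit}[h]:=x_h$; $\mathrm{merge}(v,h)$ for all $v\in N_h$. Finally restore $\bot$,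 connect every $v$ with $\mathrm{rep}(v)=v$, and return $(V,X,F,S)$. The algorithm is executed on a unit-cost random access machine with arrays and linked lists; $G$ is given by the list of its edges and $D$ as a linked ordered forest; sets are stored as linked lists (the output lists may repeat items); disjoint sets are implemented with union by rank and path compression; numberings, classification of the edges and lowest common ancestors (off-line, with a second disjoint-set structure) are computed by the algorithm and are included in its running time. Theorem. $\mathrm{ConstructWPO}^{BU}(G,D,\mathit{lift})$ runs in almost-linear time: there is a constant $C$ such that for all $G$, $D$ and $\mathit{lift}$ as above, and whatever the initial content of the memory, the algorithm terminates after at most $C\,(n+m+1)\,(\alpha(n)+1)$ steps, where $\alpha(n)=\min\{k : n\le A(k,k)\}$ is the inverse of the Ackermann function $A$ ($A(0,j)=j+1$, $A(i+1,0)=A(i,1)$, $A(i+1,j+1)=A(i,A(i+1,j))$). -/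

import Mathlib

namespace WPO

/-! ## Depth-first forests -/

/-- Finite ordered forests in first-child / next-sibling form: `node r children siblings` is the tree
with root `r` and immediate subtrees `children`, followed by the trees of `siblings`. -/
inductive Forest (V : Type) : Type
  | nil : Forest V
  | node (r : V) (children siblings : Forest V) : Forest V

/-- `DFS E cand S F S'`: a depth-first search of the relation `E` that starts with the set `S` of
discovered vertices and explores, in some order, the vertices of `cand` that are still undiscovered
when their turn comes, may produce the forest `F`; afterwards the vertices in `S'` are discovered. -/
inductive DFS {V : Type} (E : V → V → Prop) : Set V → Set V → Forest V → Set V → Prop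
  | done {cand S : Set V} : cand ⊆ S → DFS E cand S .nil S
  | visit {cand S S₁ S₂ : Set V} {r : V} {children siblings : Forest V} :
      r ∈ cand → r ∉ S →
      DFS E {v | E r v} (insert r S) children S₁ →
      DFS E cand S₁ siblings S₂ →
      DFS E cand S (.node r children siblings) S₂

/-- `D` is a depth-first forest of the directed graph with edge relation `E`. -/
def IsDepthFirstForest {V : Type} (E : V → V → Prop) (D : Forest V) : Prop :=
  DFS E Set.univ ∅ D Set.univ

/-! ## The machine -/

/-- Elements of a WPO: the vertices, and the exit `x_h` created for the vertex `h`. -/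
inductive Elem (n : ℕ) : Type
  | vtx (v : Fin n) : Elem n
  | exit (h : Fin n) : Elem n

/-- The algorithm uses two disjoint-set structures: `scc` for the partition of the vertices into the
sets that are known to be strongly connected, `anc` for the computation of lowest common ancestors. -/
inductive DSet : Type
  | scc
  | anc
  deriving DecidableEq

/-- The names of the arrays in memory. -/
inductive Arr : Type
  | dfn | post | parent | clock | order
  | link (d : DSet) | rank (d : DSet) | label (d : DSet)
  | back | pred | cross | query
  | exit | R | O
  | markP | markW | N | P | W
  | X | fwd | bwd
  deriving DecidableEq

/-- The content of a cell of each array: a number, a vertex, an element, or a linked list. -/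
abbrev Cell (n : ℕ) : Arr → Type
  -- depth-first number, post-order number, parent in the forest (`none` for a root)
  | .dfn => ℕ
  | .post => ℕ
  | .parent => Option (Fin n)
  -- global: counter of the forest traversal
  | .clock => ℕ
  -- global: the vertices in descending depth-first number
  | .order => List (Fin n)
  -- disjoint sets: parent pointer, rank, and (at the roots) the representative of the set
  | .link _ => Fin n
  | .rank _ => ℕ
  | .label _ => Fin n
  -- `back v`: sources of the back edges into `v` (this is `B`)
  | .back => List (Fin n)
  -- `pred v`: sources of the edges into `v` in the current graph without `B`
  | .pred => List (Fin n)
  -- global: the cross and forward edges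
  | .cross => List (Fin n × Fin n)
  -- `query w`: the cross and forward edges whose endpoint of smaller number is `w`,
  -- together with their other endpoint
  | .query => List (Fin n × (Fin n × Fin n))
  | .exit => Elem n
  | .R => List (Fin n × Fin n)
  | .O => List (Fin n × Fin n)
  -- `markP r = h`: `r` is in `P_h`;  `markW r = h`: `r` is in `N_h` or `W_h`
  | .markP => Option (Fin n)
  | .markW => Option (Fin n)
  -- globals: the sets `N_h`, `P_h`, `W_h` for the current `h`
  | .N => List (Fin n)
  | .P => List (Fin n)
  | .W => List (Fin n)
  -- globals: the output
  | .X => List (Elem n)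
  | .fwd => List (Elem n × Elem n)
  | .bwd => List (Elem n × Elem n)

/-- The memory: every array has a cell for each vertex and one extra cell `none`, which is used
for globals and (in `R`) for the virtual root above all trees of the forest. -/
abbrev Memory (n : ℕ) : Type := (a : Arr) → Option (Fin n) → Cell n a

/-- Programs: from a memory, either no result, or a value, the new memory and the number of steps.
Programs are composed from the instructions `read`, `write`, `test` and `forEach` below, and from
recursive procedures each of whose calls executes at least one instruction. Between two charged steps
only a bounded number of elementary operations on values at hand takes place. -/
def Prog (n : ℕ) (α : Type) : Type := Memory n → Option (α × Memory n × ℕ)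

instance (n : ℕ) : Monad (Prog n) where
  pure a := fun s => some (a, s, 0)
  bind p f := fun s =>
    match p s with
    | none => none
    | some (a, s₁, t₁) =>
      match f a s₁ with
      | none => none
      | some (b, s₂, t₂) => some (b, s₂, t₁ + t₂)

variable {n : ℕ}

/-- No result. -/
def diverge {α : Type} : Prog n α := fun _ => none

/-- One step that does nothing else. -/
def tick : Prog n Unit := fun s => some ((), s, 1)

/-- Read a cell: one step. -/
def read (a : Arr) (i : Option (Fin n)) : Prog n (Cell n a) := fun s => some (s a i, s, 1)

/-- Write a cell: one step. -/
def write (a : Arr) (i : Option (Fin n)) (x : Cell n a) : Prog n Unit :=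
  fun s => some ((), Function.update s a (Function.update (s a) i x), 1)

/-- Evaluate an elementary condition: one step. -/
def test (c : Prop) [Decidable c] : Prog n Bool := do
  tick
  pure (decide c)

/-- Read a cell and write it back changed (used for incrementing a counter and for putting an
item in front of a linked list): two steps. -/
def modify (a : Arr) (i : Option (Fin n)) (f : Cell n a → Cell n a) : Prog n Unit := do
  let x ← read a i
  write a i (f x)

/-- Run through a linked list: one step per item, in addition to the steps of the body. -/
def forEach {α : Type} : List α → (α → Prog n Unit) → Prog n Unit
  | [], _ => tick
  | x :: l, f => do
    tick
    f x
    forEach l f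

/-! ## Disjoint sets, with path compression and union by rank -/

def makeSet (d : DSet) (v : Fin n) : Prog n Unit := do
  write (.link d) v v
  write (.rank d) v 0
  write (.label d) v v

/-- The root of the set of `v`, with path compression. The first argument bounds the depth of the
recursion; there is no result if it is exceeded. -/
def findRoot (d : DSet) : ℕ → Fin n → Prog n (Fin n)
  | 0, _ => diverge
  | k + 1, v => do
    let p ← read (.link d) v
    if ← test (p = v) then
      pure v
    else do
      let r ← findRoot d k p
      write (.link d) v r
      pure r

/-- The representative of the set of `v`. -/
def rep (d : DSet) (v : Fin n) : Prog n (Fin n) := do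
  let r ← findRoot d (n + 1) v
  read (.label d) r

/-- Merge the sets of `v` and `h`; the representative of the new set is `h`. -/
def merge (d : DSet) (v h : Fin n) : Prog n Unit := do
  let a ← findRoot d (n + 1) v
  let b ← findRoot d (n + 1) h
  if ← test (a = b) then
    write (.label d) b h
  else do
    let ra ← read (.rank d) a
    let rb ← read (.rank d) b
    if ← test (rb < ra) then do
      write (.link d) b a
      write (.label d) a h
    else do
      write (.link d) a b
      write (.label d) b h
      if ← test (ra = rb) then
        write (.rank d) b (rb + 1)
      else
        pure ()

/-! ## The algorithm -/

/-- Tabulate the depth-first forest: discovery and finishing times, parents, and the list of the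
vertices in descending depth-first number. The second argument is the parent of the roots. -/
def tabulate : Forest (Fin n) → Option (Fin n) → Prog n Unit
  | .nil, _ => tick
  | .node r children siblings, p => do
    let c ← read .clock none
    write .dfn r c
    write .clock none (c + 1)
    write .parent r p
    modify .order none (fun l => r :: l)
    tabulate children (some r)
    let c' ← read .clock none
    write .post r c'
    write .clock none (c' + 1)
    tabulate siblings p

def setup (D : Forest (Fin n)) : Prog n Unit := do
  write .X none []
  write .fwd none []
  write .bwd none []
  write .cross none []
  write .R none []
  write .clock none 0
  write .order none []
  tabulate D none
  forEach (List.finRange n) fun v => do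
    makeSet .scc v
    makeSet .anc v
    write .exit v (Elem.vtx v)
    write .R v []
    write .O v []
    write .back v []
    write .pred v []
    write .query v []
    write .markP v none
    write .markW v none

/-- Sort the edges into back edges, tree edges, and cross or forward edges. An edge `(u, v)` is a
back edge if `v` is an ancestor of `u` (possibly `u` itself), that is, if `v` is discovered no later
and finished no earlier than `u`. Of the non-back edges, only the tree edges enter `pred` and `O`: the
cross and forward edges are removed from the graph, and are kept in `cross`. -/
def classifyEdges (E : List (Fin n × Fin n)) : Prog n Unit :=
  forEach E fun (u, v) => do
    let du ← read .dfn u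
    let dv ← read .dfn v
    let pu ← read .post u
    let pv ← read .post v
    if ← test (dv ≤ du ∧ pu ≤ pv) then
      modify .back v (fun l => u :: l)
    else do
      let p ← read .parent v
      if ← test (p = some u) then do
        modify .pred v (fun l => u :: l)
        modify .O v (fun l => (u, v) :: l)
      else
        modify .cross none (fun l => (u, v) :: l)

/-- Store each cross or forward edge at the lowest common ancestor of its endpoints (at the virtual
root `none` if they lie in different trees). The lowest common ancestors are found off-line with
disjoint sets: the vertices are processed in descending depth-first number, and a processed vertex is
merged into its parent. When `w` is processed, the representative of the set of a vertex `x` of larger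
number is the lowest common ancestor of `x` and `w`, or, if there is none, the root of the
tree of `x`, whose number is larger than that of `w`. -/
def removeAllCrossForwardEdges : Prog n Unit := do
  let es ← read .cross none
  forEach es fun (u, v) => do
    let du ← read .dfn u
    let dv ← read .dfn v
    if ← test (du < dv) then
      modify .query u (fun l => (v, (u, v)) :: l)
    else
      modify .query v (fun l => (u, (u, v)) :: l)
  let vs ← read .order none
  forEach vs fun w => do
    let qs ← read .query w
    forEach qs fun (x, e) => do
      let a ← rep .anc x
      let da ← read .dfn a
      let dw ← read .dfn w
      if ← test (da ≤ dw) then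
        modify .R (some a) (fun l => e :: l)
      else
        modify .R none (fun l => e :: l)
    let p ← read .parent w
    match p with
    | none => pure ()
    | some p => merge .anc w p

def restoreCrossForwardEdges (h : Option (Fin n)) : Prog n Unit := do
  let es ← read .R h
  forEach es fun (u, v) => do
    let r ← rep .scc v
    modify .pred r (fun l => u :: l)
    modify .O r (fun l => (u, v) :: l)

/-- The worklist loop of `findNestedSCCs`. The first argument bounds the number of
iterations; there is no result if it is exceeded. -/
def searchBackwards (h : Fin n) : ℕ → Prog n Unit
  | 0 => diverge
  | k + 1 => do
    let w ← read .W none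
    match w with
    | [] => pure ()
    | v :: rest => do
      write .W none rest
      modify .N none (fun l => v :: l)
      let ps ← read .pred v
      forEach ps fun p => do
        let r ← rep .scc p
        let m ← read .markW r
        if ← test (r ≠ h ∧ m ≠ some h) then do
          write .markW r (some h)
          modify .W none (fun l => r :: l)
        else
          pure ()
      searchBackwards h k

/-- Compute `N_h` and `P_h`. -/
def findNestedSCCs (h : Fin n) : Prog n Unit := do
  write .P none []
  write .N none []
  write .W none []
  let bs ← read .back h
  forEach bs fun p => do
    let r ← rep .scc p
    let m ← read .markP r
    if ← test (m ≠ some h) then do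
      write .markP r (some h)
      modify .P none (fun l => r :: l)
      if ← test (r ≠ h) then do
        write .markW r (some h)
        modify .W none (fun l => r :: l)
      else
        pure ()
    else
      pure ()
  searchBackwards h (n + 1)

/-- Add the scheduling constraints for the edges that now target `v`. -/
def addConstraints (lift : Bool) (v : Fin n) : Prog n Unit := do
  let es ← read .O v
  forEach es fun (u, v') => do
    let r ← rep .scc u
    let x ← read .exit r
    modify .fwd none (fun l => (x, Elem.vtx v') :: l)
  if ← test (lift = true) then do
    let us ← read .pred v
    forEach us fun u => do
      let r ← rep .scc u
      let x ← read .exit r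
      modify .fwd none (fun l => (x, Elem.vtx v) :: l)
  else
    pure ()

def constructWPOForSCC (lift : Bool) (h : Fin n) : Prog n Unit := do
  findNestedSCCs h
  let ps ← read .P none
  let vs ← read .N none
  if ← test (ps.isEmpty = true) then
    pure ()
  else do
    forEach vs fun v => addConstraints lift v
    modify .X none (fun l => Elem.exit h :: l)
    forEach ps fun p => do
      let r ← rep .scc p
      let x ← read .exit r
      modify .fwd none (fun l => (x, Elem.exit h) :: l)
    modify .bwd none (fun l => (Elem.exit h, Elem.vtx h) :: l)
    write .exit h (Elem.exit h)
    forEach vs fun v => merge .scc v h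

def connectWPOsOfMaximalSCCs (lift : Bool) : Prog n Unit :=
  forEach (List.finRange n) fun v => do
    let r ← rep .scc v
    if ← test (r = v) then
      addConstraints lift v
    else
      pure ()

/-- The output besides `V`: the exits, the scheduling constraints and the stabilization
constraints. The lists stand for sets; an item may be listed more than once. -/
structure Output (n : ℕ) : Type where
  X : List (Elem n)
  fwd : List (Elem n × Elem n)
  bwd : List (Elem n × Elem n)

/-- `ConstructWPO^BU(G, D, lift)` for the graph `G` with vertex set `Fin n` and edge list `E`. -/
def constructWPOBU (E : List (Fin n × Fin n)) (D : Forest (Fin n)) (lift : Bool) :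
    Prog n (Output n) := do
  setup D
  classifyEdges E
  removeAllCrossForwardEdges
  let vs ← read .order none
  forEach vs fun h => do
    restoreCrossForwardEdges (some h)
    constructWPOForSCC lift h
  restoreCrossForwardEdges none
  connectWPOsOfMaximalSCCs lift
  let X ← read .X none
  let fwd ← read .fwd none
  let bwd ← read .bwd none
  pure ⟨X, fwd, bwd⟩

/-- The inverse Ackermann function `α(n) = min {k | n ≤ A(k, k)}`. -/
noncomputable def invAck (n : ℕ) : ℕ := sInf {k | n ≤ ack k k}

end WPO

/-!
The disjoint sets are analysed with Tarjan's potential function: the potential of a node falls,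
along the levels of the Ackermann function, as the rank of its parent grows. Path compression
raises the ranks of the parents, and this pays for all but `O(α(n))` of the cost of each operation.

The lists of edges that belong to a vertex `v` are traversed only when `v` is absorbed into the
class of a header, or at the end, when `v` represents a maximal class. Either way `v` is a
representative beforehand, and `v` becomes a representative only in the beginning and when it is
processed itself. Hence no list is traversed more than twice, and since each cross or forward edge
is restored only once, the number of operations on the disjoint sets is linear.
-/

namespace WPO

open Finset Function

/-! ## The Ackermann potential -/

/-- Tarjan's potential of a node of rank `r` whose parent has rank `R`: the number of pairs `(k, i)`
of a level `k < L` and an exponent `1 ≤ i ≤ r` for which `R` has not yet reached the `i`-th iterate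
of `ack k` at `r`. It drops when the parent is replaced by an ancestor of much larger rank. -/
def nodePotential (L r R : ℕ) : ℕ :=
  #{q ∈ range L ×ˢ Icc 1 r | R < (ack q.1)^[q.2] r}

/-- The part of the cost of a find, from a node of rank `r` to a root of rank `Q`, that the
potential does not pay for. -/
def findCost (L r Q : ℕ) : ℕ :=
  #{k ∈ range L | ack k r ≤ Q} + if r = 0 then 1 else 0

theorem nodePotential_anti (L r : ℕ) : Antitone (nodePotential L r) := fun _ _ h =>
  card_le_card (monotone_filter_right _ fun _ _ hq => h.trans_lt hq)

theorem nodePotential_le (L r R : ℕ) : nodePotential L r R ≤ L * r :=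
  (card_filter_le _ _).trans (by simp)

theorem nodePotential_self (L r : ℕ) : nodePotential L r r = L * r := by
  have hlt : ∀ q ∈ range L ×ˢ Icc 1 r, r < (ack q.1)^[q.2] r := by
    rintro ⟨k, i⟩ hq
    simp only [mem_product, mem_Icc] at hq
    have hle : (ack k)^[1] r ≤ (ack k)^[i] r :=
      monotone_iterate_of_id_le (fun x => (lt_ack_right k x).le) hq.2.1 r
    exact (lt_ack_right k r).trans_le hle
  rw [nodePotential, filter_true_of_mem hlt]
  simp

theorem findCost_le (L r Q : ℕ) : findCost L r Q ≤ L + 1 := by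
  have hcard := card_filter_le (range L) fun k => ack k r ≤ Q
  rw [card_range] at hcard
  rw [findCost]
  split <;> omega

theorem ack_succ_eq_iterate (k x : ℕ) : ack (k + 1) x = (ack k)^[x + 1] 1 := by
  induction x with
  | zero => simp
  | succ x ih => rw [ack_succ_succ, ih, ← iterate_succ_apply' (ack k)]

theorem ack_succ_le_iterate (k : ℕ) {r : ℕ} (hr : 1 ≤ r) : ack (k + 1) r ≤ (ack k)^[r + 1] r :=
  (ack_succ_eq_iterate k r).trans_le ((ack_mono_right k).iterate (r + 1) hr)

theorem nodePotential_lt {L r R Q k i : ℕ} (hk : k < L) (hi : i ∈ Icc 1 r)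
    (hR : R < (ack k)^[i] r) (hQ : (ack k)^[i] r ≤ Q) :
    nodePotential L r Q < nodePotential L r R := by
  refine card_lt_card ((ssubset_iff_of_subset
    (monotone_filter_right _ fun _ _ hq => (hR.le.trans hQ).trans_lt hq)).2 ⟨(k, i), ?_, ?_⟩)
  · rw [mem_filter, mem_product, mem_range]
    exact ⟨⟨hk, hi⟩, hR⟩
  · rw [mem_filter]
    exact fun h => h.2.not_ge hQ

theorem exists_ack_le_lt_ack_succ {L r R : ℕ} (hr : r < R) (hL : R < ack L r) :
    ∃ k < L, ack k r ≤ R ∧ R < ack (k + 1) r := by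
  have hex : ∃ m, R < ack m r := ⟨L, hL⟩
  obtain ⟨k, hk⟩ : ∃ k, Nat.find hex = k + 1 := Nat.exists_eq_succ_of_ne_zero fun h0 => by
    have := Nat.find_spec hex
    rw [h0, ack_zero] at this
    omega
  have hmin := Nat.find_min hex (m := k) (by omega)
  have hle := Nat.find_min' hex hL
  exact ⟨k, by omega, not_lt.1 hmin, hk ▸ Nat.find_spec hex⟩

/-- The first iterate of `ack k` at `r` above `R` is at most `ack k R ≤ Q`. Either the potential
counts it, or its exponent is `r + 1` and it bounds `ack (k + 1) r`, which the potential counts. -/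
theorem nodePotential_lt_of_ack_le {L r R Q k : ℕ} (hr : 1 ≤ r) (hk : ack k r ≤ R)
    (hR : R < ack (k + 1) r) (hQ : ack k R ≤ Q) (hL : Q < ack L r) :
    nodePotential L r Q < nodePotential L r R := by
  by_cases h : R < (ack k)^[r] r
  · have hex : ∃ i, R < (ack k)^[i] r := ⟨r, h⟩
    have hle : Nat.find hex ≤ r := Nat.find_min' hex h
    obtain ⟨i, hi⟩ : ∃ i, Nat.find hex = i + 1 := Nat.exists_eq_succ_of_ne_zero fun h0 => by
      have := (lt_ack_right k r).trans_le hk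
      exact this.not_gt (by simpa [h0] using Nat.find_spec hex)
    have hiR : (ack k)^[i] r ≤ R := not_lt.1 (Nat.find_min hex (m := i) (by omega))
    have hkL : k < L := by
      rw [← ack_lt_iff_left (n := r)]
      exact (hk.trans (lt_ack_right k R).le).trans_lt (hQ.trans_lt hL)
    refine nodePotential_lt hkL (mem_Icc.2 ⟨by omega, hi ▸ hle⟩) (hi ▸ Nat.find_spec hex) ?_
    rw [iterate_succ_apply']
    exact (ack_mono_right k hiR).trans hQ
  · have hsucc : ack (k + 1) r ≤ Q := by
      refine (ack_succ_le_iterate k hr).trans (le_trans ?_ hQ)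
      rw [iterate_succ_apply']
      exact ack_mono_right k (not_lt.1 h)
    exact nodePotential_lt (ack_lt_iff_left.1 (hsucc.trans_lt hL)) (mem_Icc.2 ⟨le_rfl, hr⟩) hR hsucc

/-- If the potential of a node does not drop, then the node is the last one of its level on the path
to the root, so there are fewer levels left for the rest of the path. -/
theorem nodePotential_add_findCost_le {L r R Q : ℕ} (hL : Q < ack L 1) (hr : r < R) (hR : R ≤ Q) :
    nodePotential L r Q + 1 + findCost L R Q ≤ nodePotential L r R + findCost L r Q := by
  have hsub : {k ∈ range L | ack k R ≤ Q} ⊆ {k ∈ range L | ack k r ≤ Q} :=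
    monotone_filter_right _ fun k _ hk => (ack_mono_right k hr.le).trans hk
  have hcard := card_le_card hsub
  have hanti := nodePotential_anti L r hR
  have hR0 : R ≠ 0 := by omega
  rcases Nat.eq_zero_or_pos r with rfl | hr1
  · simp only [findCost, hR0, if_true, if_false] at hanti ⊢
    omega
  simp only [findCost, hR0, hr1.ne', if_false]
  have hQL : Q < ack L r := hL.trans_le (ack_mono_right L hr1)
  obtain ⟨k, hkL, hk, hkR⟩ := exists_ack_le_lt_ack_succ hr (hR.trans_lt hQL)
  by_cases hkQ : ack k R ≤ Q
  · have := nodePotential_lt_of_ack_le hr1 hk hkR hkQ hQL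
    omega
  · have := card_lt_card ((ssubset_iff_of_subset hsub).2
      ⟨k, by simp [hkL, hk.trans hR], by simp [hkQ]⟩)
    omega

theorem le_ack_invAck_succ (n : ℕ) : n ≤ ack (invAck n + 1) 1 := by
  have hn : n ≤ ack (invAck n) (invAck n) :=
    Nat.sInf_mem (s := {k | n ≤ ack k k}) ⟨n, (lt_ack_left n n).le⟩
  rw [ack_succ_succ, ack_succ_zero]
  exact hn.trans (ack_mono_right _ (lt_ack_left _ 1).le)

/-! ## Ranked forests -/

section RankedForest

variable {V : Type*} [Fintype V] [DecidableEq V]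

/-- The parent pointers of a disjoint-set forest with union by rank: roots point to themselves, and
`root x` is the root of the tree of `x`. The bound on the sum keeps the ranks below the number of
nodes. -/
structure IsRankedForest (parent : V → V) (rank : V → ℕ) (root : V → V) : Prop where
  rank_lt : ∀ x, parent x ≠ x → rank x < rank (parent x)
  sum_rank_le : ∑ x with parent x = x, (rank x + 1) ≤ Fintype.card V
  parent_root : ∀ x, parent (root x) = root x
  root_parent : ∀ x, root (parent x) = root x
  root_eq : ∀ x, parent x = x → root x = x

/-- The potential of a disjoint-set forest. -/
def forestPotential (L : ℕ) (parent : V → V) (rank : V → ℕ) : ℕ :=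
  ∑ x, nodePotential L (rank x) (rank (parent x))

theorem isRankedForest_id : IsRankedForest (id : V → V) (fun _ => 0) id where
  rank_lt _ h := absurd rfl h
  sum_rank_le := by simp
  parent_root _ := rfl
  root_parent _ := rfl
  root_eq _ _ := rfl

/-- The root of `x` after the root `a` has been linked below the root `b`. -/
def linkRoot (root : V → V) (a b x : V) : V :=
  if root x = a ∨ root x = b then b else root x

variable {parent : V → V} {rank : V → ℕ} {root : V → V}

namespace IsRankedForest

theorem root_root (h : IsRankedForest parent rank root) (x : V) : root (root x) = root x :=
  h.root_eq _ (h.parent_root x)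

theorem rank_root_lt (h : IsRankedForest parent rank root) (x : V) :
    rank (root x) < Fintype.card V := by
  have hx : root x ∈ univ.filter fun y => parent y = y := by simp [h.parent_root]
  exact (single_le_sum (f := fun y => rank y + 1) (fun _ _ => Nat.zero_le _) hx).trans h.sum_rank_le

theorem rank_le_rank_root (h : IsRankedForest parent rank root) (x : V) :
    rank x ≤ rank (root x) := by
  obtain ⟨B, hB⟩ : ∃ B, ∀ y, rank y ≤ B :=
    ⟨univ.sup rank, fun y => le_sup (mem_univ y)⟩
  induction hd : B - rank x using Nat.strong_induction_on generalizing x with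
  | _ d ih =>
    by_cases hx : parent x = x
    · rw [h.root_eq x hx]
    · have hlt := h.rank_lt x hx
      have hle := ih (B - rank (parent x)) (by have := hB (parent x); omega) _ rfl
      rw [h.root_parent] at hle
      omega

theorem rank_parent_le (h : IsRankedForest parent rank root) (x : V) :
    rank (parent x) ≤ rank (root x) :=
  h.root_parent x ▸ h.rank_le_rank_root (parent x)

theorem rank_lt_card (h : IsRankedForest parent rank root) (x : V) : rank x < Fintype.card V :=
  (h.rank_le_rank_root x).trans_lt (h.rank_root_lt x)

theorem compress (h : IsRankedForest parent rank root) {v : V} (hv : parent v ≠ v) :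
    IsRankedForest (update parent v (root v)) rank root := by
  have hlt : rank v < rank (root v) := (h.rank_lt v hv).trans_le (h.rank_parent_le v)
  have hroot : ∀ x, root x ≠ v := fun x e => hv (e ▸ h.parent_root x)
  have hfix : ∀ x, update parent v (root v) x = x ↔ parent x = x := fun x => by
    rcases eq_or_ne x v with rfl | hx
    · simp [hroot x, hv]
    · simp [hx]
  refine ⟨fun x => ?_, by simpa only [hfix] using h.sum_rank_le, fun x => ?_, fun x => ?_,
    fun x hx => h.root_eq x ((hfix x).1 hx)⟩
  · rcases eq_or_ne x v with rfl | hx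
    · simpa using fun _ => hlt
    · simpa [hx] using h.rank_lt x
  · rw [update_of_ne (hroot x), h.parent_root]
  · rcases eq_or_ne x v with rfl | hx
    · simp [h.root_root]
    · rw [update_of_ne hx, h.root_parent]

theorem forestPotential_compress_add_le (h : IsRankedForest parent rank root) {L : ℕ}
    (hL : Fintype.card V ≤ ack L 1) {v : V} (hv : parent v ≠ v) :
    forestPotential L (update parent v (root v)) rank + 1 +
        findCost L (rank (parent v)) (rank (root v)) ≤
      forestPotential L parent rank + findCost L (rank v) (rank (root v)) := by
  have hstep := nodePotential_add_findCost_le ((h.rank_root_lt v).trans_le hL) (h.rank_lt v hv)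
    (h.rank_parent_le v)
  have hsum : ∑ x ∈ univ.erase v, nodePotential L (rank x) (rank (update parent v (root v) x)) =
      ∑ x ∈ univ.erase v, nodePotential L (rank x) (rank (parent x)) :=
    sum_congr rfl fun x hx => by rw [update_of_ne (ne_of_mem_erase hx)]
  simp only [forestPotential, ← add_sum_erase univ _ (mem_univ v), hsum, update_self]
  omega

theorem link_sum_rank_le (h : IsRankedForest parent rank root) {a b : V} (hab : a ≠ b)
    (ha : parent a = a) (hb : parent b = b) (hr : rank a ≤ rank b) :
    ∑ x with update parent a b x = x, (update rank b (max (rank b) (rank a + 1)) x + 1) ≤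
      Fintype.card V := by
  refine le_trans ?_ h.sum_rank_le
  have hrest : ∑ x ∈ (univ.erase a).erase b, (if update parent a b x = x then
        update rank b (max (rank b) (rank a + 1)) x + 1 else 0) =
      ∑ x ∈ (univ.erase a).erase b, (if parent x = x then rank x + 1 else 0) :=
    sum_congr rfl fun x hx => by
      simp only [mem_erase] at hx
      rw [update_of_ne hx.1, update_of_ne hx.2.1]
  have hba : b ∈ univ.erase a := mem_erase.2 ⟨hab.symm, mem_univ b⟩
  simp only [sum_filter, ← add_sum_erase univ _ (mem_univ a), ← add_sum_erase _ _ hba, hrest]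
  simp only [update_self, update_of_ne hab.symm, hab.symm, ha, hb, if_true, if_false]
  omega

theorem link (h : IsRankedForest parent rank root) {a b : V} (hab : a ≠ b) (ha : parent a = a)
    (hb : parent b = b) (hr : rank a ≤ rank b) :
    IsRankedForest (update parent a b) (update rank b (max (rank b) (rank a + 1)))
      (linkRoot root a b) := by
  refine ⟨fun x => ?_, h.link_sum_rank_le hab ha hb hr, fun x => ?_, fun x => ?_, fun x => ?_⟩
  · rcases eq_or_ne x a with rfl | hxa
    · simp [hab]
    · rw [update_of_ne hxa]
      intro hx
      have hxb : x ≠ b := fun e => hx (e ▸ hb)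
      rw [update_of_ne hxb]
      have hlt := h.rank_lt x hx
      rcases eq_or_ne (parent x) b with hpb | hpb
      · rw [hpb] at hlt ⊢
        simp [hlt]
      · rwa [update_of_ne hpb]
  · unfold linkRoot
    split_ifs with hx
    · rw [update_of_ne hab.symm, hb]
    · rw [update_of_ne fun e => hx (Or.inl e), h.parent_root]
  · rcases eq_or_ne x a with rfl | hxa
    · simp [linkRoot, h.root_eq, ha, hb]
    · rw [update_of_ne hxa]
      simp only [linkRoot, h.root_parent]
  · rcases eq_or_ne x a with rfl | hxa
    · simp [hab.symm]
    · rw [update_of_ne hxa]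
      intro hx
      simp only [linkRoot, h.root_eq x hx, hxa, false_or]
      split_ifs with hxb
      exacts [hxb.symm, rfl]

end IsRankedForest

theorem forestPotential_link_le (L : ℕ) {a b : V} (ha : parent a = a)
    (hb : parent b = b) (hab : a ≠ b) (hr : rank a ≤ rank b) :
    forestPotential L (update parent a b) (update rank b (max (rank b) (rank a + 1))) ≤
      forestPotential L parent rank + L := by
  set rank' := update rank b (max (rank b) (rank a + 1)) with hrank'
  have hmono : rank ≤ rank' := le_update_iff.2 ⟨le_max_left _ _, fun _ _ => le_rfl⟩
  have hnode : ∀ x, nodePotential L (rank' x) (rank' (update parent a b x)) ≤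
      nodePotential L (rank x) (rank (parent x)) + if x = b then L else 0 := by
    intro x
    rcases eq_or_ne x b with rfl | hxb
    · rw [update_of_ne hab.symm, hb, nodePotential_self, nodePotential_self, if_pos rfl,
        ← mul_add_one]
      gcongr
      simp [hrank', hr]
    · have hx : rank' x = rank x := update_of_ne hxb _ _
      rw [hx, if_neg hxb, add_zero]
      rcases eq_or_ne x a with rfl | hxa
      · rw [ha, nodePotential_self]
        exact nodePotential_le _ _ _
      · rw [update_of_ne hxa]
        exact nodePotential_anti _ _ (hmono _)
  calc _ ≤ _ := sum_le_sum fun x _ => hnode x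
    _ = _ := by simp [sum_add_distrib, forestPotential]

end RankedForest

/-! ## Amortized analysis of programs -/

section ProgramLogic

variable {n : ℕ} {α β : Type} {Φ : Memory n → ℤ} {s : Memory n} {A B : Set Arr}

/-- The program `p`, started in `s`, has a result, and `Q` holds of it, of the final memory and of
the amortized cost with respect to the potential `Φ`: the number of steps plus the change of `Φ`. -/
def Run (Φ : Memory n → ℤ) (p : Prog n α) (s : Memory n) (Q : α → Memory n → ℤ → Prop) : Prop :=
  ∃ a s' t, p s = some (a, s', t) ∧ Q a s' (t + Φ s' - Φ s)

/-- The memory `s` with the content `x` in cell `i` of the array `a`. -/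
def store (s : Memory n) (a : Arr) (i : Option (Fin n)) (x : Cell n a) : Memory n :=
  Function.update s a (Function.update (s a) i x)

@[simp]
theorem store_apply_self (a : Arr) (i j : Option (Fin n)) (x : Cell n a) :
    store s a i x a j = if j = i then x else s a j := by
  simp [store, Function.update_apply]

@[simp]
theorem store_of_ne {a b : Arr} (hba : b ≠ a) (i : Option (Fin n)) (x : Cell n a) :
    store s a i x b = s b :=
  Function.update_of_ne hba _ _

theorem store_apply_of_ne {a : Arr} {i j : Option (Fin n)} (hji : j ≠ i) (x : Cell n a) (b : Arr) :
    store s a i x b j = s b j := by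
  by_cases hba : b = a
  · subst hba
    simp [hji]
  · simp [hba]

theorem Run.mono {p : Prog n α} {Q Q' : α → Memory n → ℤ → Prop} (h : Run Φ p s Q)
    (hQ : ∀ a s' c, Q a s' c → Q' a s' c) : Run Φ p s Q' := by
  obtain ⟨a, s', t, hp, hq⟩ := h
  exact ⟨a, s', t, hp, hQ _ _ _ hq⟩

theorem Run.steps_le {p : Prog n α} {Q : α → Memory n → ℤ → Prop} (h : Run Φ p s Q)
    (hs : Φ s = 0) (hΦ : ∀ s', 0 ≤ Φ s') : Run 0 p s fun a s' t => ∃ c, t ≤ c ∧ Q a s' c := by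
  obtain ⟨a, s', t, hp, hq⟩ := h
  refine ⟨a, s', t, hp, _, ?_, hq⟩
  simpa [hs] using hΦ s'

theorem run_of_eq_some {p : Prog n α} {a : α} {s' : Memory n} {t : ℕ} (hp : p s = some (a, s', t))
    (Q : α → Memory n → ℤ → Prop) : Run Φ p s Q ↔ Q a s' (t + Φ s' - Φ s) := by
  simp [Run, hp]

theorem run_pure (a : α) (Q : α → Memory n → ℤ → Prop) : Run Φ (pure a) s Q ↔ Q a s 0 := by
  rw [run_of_eq_some (rfl : (pure a : Prog n α) s = some (a, s, 0))]
  simp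

theorem bind_apply (p : Prog n α) (f : α → Prog n β) : (p >>= f) s =
    (p s).bind fun (a, s₁, t₁) => (f a s₁).map fun (b, s₂, t₂) => (b, s₂, t₁ + t₂) := by
  change (match p s with
    | none => none
    | some (a, s₁, t₁) => match f a s₁ with
      | none => none
      | some (b, s₂, t₂) => some (b, s₂, t₁ + t₂)) = _
  rcases p s with _ | ⟨a, s₁, t₁⟩
  · rfl
  · rcases h : f a s₁ with _ | ⟨b, s₂, t₂⟩ <;> simp [h]

theorem run_bind (p : Prog n α) (f : α → Prog n β) (Q : β → Memory n → ℤ → Prop) :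
    Run Φ (p >>= f) s Q ↔
      Run Φ p s fun a s₁ c₁ => Run Φ (f a) s₁ fun b s₂ c₂ => Q b s₂ (c₁ + c₂) := by
  have hcost (t₁ t₂ : ℕ) (s₁ s₂ : Memory n) : ((t₁ + t₂ : ℕ) + Φ s₂ - Φ s : ℤ) =
      t₁ + Φ s₁ - Φ s + (t₂ + Φ s₂ - Φ s₁) := by
    push_cast
    ring
  constructor
  · rintro ⟨b, s₂, t, h, hq⟩
    simp only [bind_apply, Option.bind_eq_some_iff, Option.map_eq_some_iff, Prod.exists,
      Prod.mk.injEq] at h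
    obtain ⟨a, s₁, t₁, hp, b', s₂', t₂, hf, rfl, rfl, rfl⟩ := h
    exact ⟨a, s₁, t₁, hp, b', s₂', t₂, hf, by simpa only [hcost t₁ t₂ s₁] using hq⟩
  · rintro ⟨a, s₁, t₁, hp, b, s₂, t₂, hf, hq⟩
    exact ⟨b, s₂, t₁ + t₂, by simp [bind_apply, hp, hf], by rwa [hcost t₁ t₂ s₁]⟩

theorem run_tick (Q : Unit → Memory n → ℤ → Prop) : Run Φ tick s Q ↔ Q () s 1 := by
  rw [run_of_eq_some (rfl : tick s = some ((), s, 1))]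
  simp

theorem run_read (a : Arr) (i : Option (Fin n)) (Q : Cell n a → Memory n → ℤ → Prop) :
    @Run n (no_index (Cell n a)) Φ (read a i) s Q ↔ Q (s a i) s 1 := by
  rw [run_of_eq_some (rfl : read a i s = some (s a i, s, 1))]
  simp

theorem run_write (a : Arr) (i : Option (Fin n)) (x : Cell n a)
    (Q : Unit → Memory n → ℤ → Prop) :
    Run Φ (write a i x) s Q ↔ Q () (store s a i x) (1 + Φ (store s a i x) - Φ s) := by
  have hp : write a i x s = some ((), store s a i x, 1) := rfl
  rw [run_of_eq_some hp, Nat.cast_one]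

theorem run_modify (a : Arr) (i : Option (Fin n)) (f : Cell n a → Cell n a)
    (Q : Unit → Memory n → ℤ → Prop) :
    Run Φ (modify a i f) s Q ↔
      Q () (store s a i (f (s a i))) (2 + Φ (store s a i (f (s a i))) - Φ s) := by
  have hp : modify a i f s = some ((), store s a i (f (s a i)), 2) := rfl
  rw [run_of_eq_some hp, Nat.cast_two]

theorem run_test (c : Prop) [Decidable c] (Q : Bool → Memory n → ℤ → Prop) :
    Run Φ (test c) s Q ↔ Q (decide c) s 1 := by
  simp [test, run_bind, run_tick, run_pure]

theorem run_ite (c : Prop) [Decidable c] (p q : Prog n α) (Q : α → Memory n → ℤ → Prop) :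
    Run Φ (if c then p else q) s Q ↔ (c → Run Φ p s Q) ∧ (¬c → Run Φ q s Q) := by
  split <;> simp [*]

/-! ### Framing -/

/-- Only the arrays in `A` differ between `s` and `s'`. -/
def Frame (A : Set Arr) (s s' : Memory n) : Prop := ∀ a ∉ A, s' a = s a

theorem Frame.refl (A : Set Arr) (s : Memory n) : Frame A s s := fun _ _ => rfl

theorem Frame.trans {s₁ s₂ : Memory n} (h₁ : Frame A s s₁) (h₂ : Frame B s₁ s₂)
    (hBA : B ⊆ A := by simp [Set.insert_subset_iff]) : Frame A s s₂ :=
  fun a ha => (h₂ a fun h => ha (hBA h)).trans (h₁ a ha)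

theorem Frame.mono {s' : Memory n} (h : Frame A s s')
    (hAB : A ⊆ B := by simp [Set.insert_subset_iff]) : Frame B s s' :=
  fun a ha => h a fun h => ha (hAB h)

/-- The program `p` writes only to the arrays in `A`. -/
def Modifies (A : Set Arr) (p : Prog n α) : Prop :=
  ∀ s a s' t, p s = some (a, s', t) → Frame A s s'

namespace Modifies

theorem pure {a : α} : Modifies A (pure a : Prog n α) := by
  rintro s _ _ _ h
  cases h
  exact Frame.refl A s

theorem diverge : Modifies A (diverge : Prog n α) := nofun

theorem bind {p : Prog n α} {f : α → Prog n β} (hp : Modifies A p) (hf : ∀ a, Modifies A (f a)) :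
    Modifies A (p >>= f) := by
  intro s b s₂ t h
  simp only [bind_apply, Option.bind_eq_some_iff, Option.map_eq_some_iff, Prod.exists,
    Prod.mk.injEq] at h
  obtain ⟨a, s₁, t₁, h₁, b', s₂', t₂, h₂, rfl, rfl, rfl⟩ := h
  exact (hp _ _ _ _ h₁).trans (hf _ _ _ _ _ h₂) le_rfl

theorem univ {p : Prog n α} : Modifies Set.univ p :=
  fun _ _ _ _ _ a ha => absurd (Set.mem_univ a) ha

theorem tick : Modifies A (tick : Prog n Unit) := by
  rintro s _ _ _ h
  cases h
  exact Frame.refl A s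

theorem read {a : Arr} {i : Option (Fin n)} : Modifies A (read a i) := by
  rintro s _ _ _ h
  cases h
  exact Frame.refl A s

theorem write {a : Arr} {i : Option (Fin n)} {x : Cell n a} (ha : a ∈ A := by simp) :
    Modifies A (write a i x) := by
  rintro s _ _ _ h b hb
  cases h
  exact Function.update_of_ne (ne_of_mem_of_not_mem ha hb).symm _ _

theorem modify {a : Arr} {i : Option (Fin n)} {f : Cell n a → Cell n a} (ha : a ∈ A := by simp) :
    Modifies A (modify a i f) :=
  read.bind fun _ => write ha

theorem ite {c : Prop} [Decidable c] {p q : Prog n α} (hp : Modifies A p) (hq : Modifies A q) :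
    Modifies A (if c then p else q) := by
  split <;> assumption

theorem test {c : Prop} [Decidable c] {p q : Prog n α} (hp : Modifies A p) (hq : Modifies A q) :
    Modifies A (do if ← test c then p else q) :=
  (tick.bind fun _ => pure).bind fun _ => ite hp hq

theorem forEach {l : List α} {f : α → Prog n Unit} (hf : ∀ x, Modifies A (f x)) :
    Modifies A (forEach l f) := by
  induction l with
  | nil => exact tick
  | cons x l ih => exact tick.bind fun _ => (hf x).bind fun _ => ih

theorem mono {p : Prog n α} (h : Modifies A p)
    (hAB : A ⊆ B := by simp [Set.insert_subset_iff]) : Modifies B p :=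
  fun s a s' t hp => (h s a s' t hp).mono hAB

end Modifies

theorem Run.frame {p : Prog n α} {Q : α → Memory n → ℤ → Prop} (h : Run Φ p s Q)
    (hp : Modifies A p) : Run Φ p s fun a s' c => Q a s' c ∧ Frame A s s' := by
  obtain ⟨a, s', t, hs, hq⟩ := h
  exact ⟨a, s', t, hs, hq, hp _ _ _ _ hs⟩

/-! ### Loops -/

/-- In the invariant, `I l s' c` refers to the items `l` that remain and the amortized cost `c` so
far. -/
theorem run_forEach {l : List α} {f : α → Prog n Unit} (I : List α → Memory n → ℤ → Prop)
    (h0 : I l s 0)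
    (hstep : ∀ x l s' c, I (x :: l) s' c → Run Φ (f x) s' fun _ s'' c' => I l s'' (c + 1 + c')) :
    Run Φ (forEach l f) s fun _ s' c => I [] s' (c - 1) := by
  suffices H : ∀ c, I l s c → Run Φ (forEach l f) s fun _ s' c' => I [] s' (c + c' - 1) by
    simpa only [zero_add] using H 0 h0
  clear h0
  induction l generalizing s with
  | nil => simp only [forEach, run_tick, add_sub_cancel_right, imp_self, implies_true]
  | cons x l ih =>
    intro c hI
    simp only [forEach, run_bind, run_tick]
    refine (hstep x l s c hI).mono fun _ s₁ c₁ h₁ => (ih _ h₁).mono fun _ s₂ c₂ h₂ => ?_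
    rwa [← add_assoc, ← add_assoc]

theorem run_forEach_of_cost_le {l : List α} {f : α → Prog n Unit} (I : List α → Memory n → Prop)
    (cost : α → ℤ) (hf : ∀ x, Modifies A (f x)) (h0 : I l s)
    (hstep : ∀ x l s', I (x :: l) s' → Frame A s s' →
      Run Φ (f x) s' fun _ s'' c => I l s'' ∧ c ≤ cost x) :
    Run Φ (forEach l f) s fun _ s' c =>
      I [] s' ∧ Frame A s s' ∧ c ≤ (l.map fun x => cost x + 1).sum + 1 := by
  refine (run_forEach (fun l' s' c => I l' s' ∧ Frame A s s' ∧
    c + (l'.map fun x => cost x + 1).sum ≤ (l.map fun x => cost x + 1).sum)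
    ⟨h0, Frame.refl A s, by simp⟩ ?_).mono ?_
  · rintro x l s' c ⟨hI, hF, hc⟩
    refine ((hstep x l s' hI hF).frame (hf x)).mono ?_
    rintro _ s'' c' ⟨⟨hI', hc'⟩, hF'⟩
    rw [List.map_cons, List.sum_cons] at hc
    exact ⟨hI', hF.trans hF' le_rfl, by linarith⟩
  · rintro _ s' c ⟨hI, hF, hc⟩
    rw [List.map_nil, List.sum_nil] at hc
    exact ⟨hI, hF, by linarith⟩

theorem run_forEach_of_const_cost_le {l : List α} {f : α → Prog n Unit}
    (I : List α → Memory n → Prop) (C : ℤ) (hf : ∀ x, Modifies A (f x)) (h0 : I l s)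
    (hstep : ∀ x l s', I (x :: l) s' → Frame A s s' →
      Run Φ (f x) s' fun _ s'' c => I l s'' ∧ c ≤ C) :
    Run Φ (forEach l f) s fun _ s' c =>
      I [] s' ∧ Frame A s s' ∧ c ≤ (C + 1) * l.length + 1 := by
  simpa only [List.map_const', List.sum_replicate, nsmul_eq_mul, mul_comm] using
    run_forEach_of_cost_le I (fun _ => C) hf h0 hstep

end ProgramLogic

/-! ## Disjoint sets in memory -/

section Labelling

variable {V : Type*} {root label σ : V → V} {v h b x : V}

/-- The function `σ` maps each node of a disjoint-set forest to the label of its root, which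
belongs to the same tree. -/
structure IsLabelling (root label σ : V → V) : Prop where
  root_label_root : ∀ x, root (label (root x)) = root x
  eq_label_root : ∀ x, σ x = label (root x)

theorem IsLabelling.eq_iff (hσ : IsLabelling root label σ) {x y : V} :
    σ x = σ y ↔ root x = root y := by
  simp only [hσ.eq_label_root]
  refine ⟨fun h => ?_, fun h => h ▸ rfl⟩
  rw [← hσ.root_label_root x, h, hσ.root_label_root]

theorem IsLabelling.idem (hσ : IsLabelling root label σ) (x : V) : σ (σ x) = σ x :=
  hσ.eq_iff.2 <| by rw [hσ.eq_label_root, hσ.root_label_root]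

variable [DecidableEq V]

/-- The representatives after the classes of `v` and `h` have been merged in favour of `h`. -/
def mergeRep (σ : V → V) (v h x : V) : V :=
  if σ x = σ v ∨ σ x = σ h then h else σ x

theorem eq_or_of_mergeRep_eq_self (hx : mergeRep σ v h x = x) : x = h ∨ σ x = x ∧ x ≠ v := by
  unfold mergeRep at hx
  split_ifs at hx with hc
  · exact Or.inl hx.symm
  · exact Or.inr ⟨hx, fun hxv => hc (Or.inl (hxv ▸ rfl))⟩

theorem IsLabelling.merge (hσ : IsLabelling root label σ) {root' : V → V}
    (hroot' : ∀ x, root' x = if root x = root v ∨ root x = root h then b else root x)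
    (hb : b = root v ∨ b = root h) :
    IsLabelling root' (Function.update label b h) (mergeRep σ v h) := by
  refine ⟨fun x => ?_, fun x => ?_⟩ <;> by_cases hx : root x = root v ∨ root x = root h
  · simp [hroot', hx]
  · have hxb : root x ≠ b := fun e => hx (hb.imp e.trans e.trans)
    rw [hroot' x, if_neg hx, Function.update_of_ne hxb, hroot', hσ.root_label_root, if_neg hx]
  · simp [mergeRep, hσ.eq_iff, hroot', hx]
  · have hxb : root x ≠ b := fun e => hx (hb.imp e.trans e.trans)
    rw [hroot' x, if_neg hx, Function.update_of_ne hxb, ← hσ.eq_label_root, mergeRep,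
      if_neg (by simpa only [hσ.eq_iff] using hx)]

end Labelling

section DisjointSets

variable {n L : ℕ} {s s' : Memory n} {d : DSet} {root σ : Fin n → Fin n}

/-- The parent pointers of `d`. -/
def parents (d : DSet) (s : Memory n) (x : Fin n) : Fin n := s (.link d) (some x)

/-- The ranks of `d`. -/
def ranks (d : DSet) (s : Memory n) (x : Fin n) : ℕ := s (.rank d) (some x)

/-- The labels of `d`, which are meaningful at the roots only. -/
def labels (d : DSet) (s : Memory n) (x : Fin n) : Fin n := s (.label d) (some x)

theorem parents_congr (h : s' (.link d) = s (.link d)) : parents d s' = parents d s := by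
  funext x
  simp only [parents, h]

theorem ranks_congr (h : s' (.rank d) = s (.rank d)) : ranks d s' = ranks d s := by
  funext x
  simp only [ranks, h]

theorem labels_congr (h : s' (.label d) = s (.label d)) : labels d s' = labels d s := by
  funext x
  simp only [labels, h]

@[simp]
theorem parents_store_link (v r : Fin n) :
    parents d (store s (.link d) (some v) r) = Function.update (parents d s) v r := by
  funext x
  simp [parents, Function.update_apply]

@[simp]
theorem ranks_store_rank (v : Fin n) (r : ℕ) :
    ranks d (store s (.rank d) (some v) r) = Function.update (ranks d s) v r := by
  funext x
  simp [ranks, Function.update_apply]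

@[simp]
theorem labels_store_label (v r : Fin n) :
    labels d (store s (.label d) (some v) r) = Function.update (labels d s) v r := by
  funext x
  simp [labels, Function.update_apply]

section StoreOfNe

variable {a : Arr} {i : Option (Fin n)} {x : Cell n a}

@[simp]
theorem parents_store_of_ne (h : .link d ≠ a) : parents d (store s a i x) = parents d s :=
  parents_congr (store_of_ne h i x)

@[simp]
theorem ranks_store_of_ne (h : .rank d ≠ a) : ranks d (store s a i x) = ranks d s :=
  ranks_congr (store_of_ne h i x)

@[simp]
theorem labels_store_of_ne (h : .label d ≠ a) : labels d (store s a i x) = labels d s :=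
  labels_congr (store_of_ne h i x)

end StoreOfNe

/-- The potential of the memory: each unit of the potential of the two disjoint-set forests pays
for the three steps that a call of `findRoot` makes at one node. -/
def potential (L : ℕ) (s : Memory n) : ℤ :=
  3 * (forestPotential L (parents .scc s) (ranks .scc s) +
    forestPotential L (parents .anc s) (ranks .anc s) : ℕ)

theorem potential_nonneg (L : ℕ) (s : Memory n) : 0 ≤ potential L s := by
  unfold potential
  positivity

@[simp]
theorem potential_store {a : Arr} (i : Option (Fin n)) (x : Cell n a)
    (hlink : ∀ d, .link d ≠ a) (hrank : ∀ d, .rank d ≠ a) :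
    potential L (store s a i x) = potential L s := by
  simp [potential, hlink, hrank]

theorem run_write_of_ne {a : Arr} {i : Option (Fin n)} {x : Cell n a}
    {Q : Unit → Memory n → ℤ → Prop} (hlink : ∀ d, .link d ≠ a) (hrank : ∀ d, .rank d ≠ a) :
    Run (potential L) (write a i x) s Q ↔ Q () (store s a i x) 1 := by
  rw [run_write, potential_store i x hlink hrank, add_sub_cancel_right]

theorem run_modify_of_ne {a : Arr} {i : Option (Fin n)} {f : Cell n a → Cell n a}
    {Q : Unit → Memory n → ℤ → Prop} (hlink : ∀ d, .link d ≠ a) (hrank : ∀ d, .rank d ≠ a) :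
    Run (potential L) (modify a i f) s Q ↔ Q () (store s a i (f (s a i))) 2 := by
  rw [run_modify, potential_store i _ hlink hrank, add_sub_cancel_right]

theorem potential_sub_potential (d : DSet) (hother : ∀ d' ≠ d, parents d' s' = parents d' s ∧
      ranks d' s' = ranks d' s := by simp +contextual) :
    potential L s' - potential L s = 3 * (forestPotential L (parents d s') (ranks d s') -
      forestPotential L (parents d s) (ranks d s)) := by
  cases d
  · rw [potential, potential, (hother .anc nofun).1, (hother .anc nofun).2]
    push_cast
    ring
  · rw [potential, potential, (hother .scc nofun).1, (hother .scc nofun).2]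
    push_cast
    ring

theorem modifies_findRoot {k : ℕ} {v : Fin n} : Modifies {.link d} (findRoot d k v) := by
  induction k generalizing v with
  | zero => exact .diverge
  | succ k ih =>
    exact .bind .read fun p => .test .pure <|
      .bind ih fun _ => .bind .write fun _ => .pure

theorem run_findRoot (hL : n ≤ ack L 1) {k : ℕ} {v : Fin n}
    (h : IsRankedForest (parents d s) (ranks d s) root) (hk : n ≤ k + ranks d s v) :
    Run (potential L) (findRoot d k v) s fun r s' c => r = root v ∧
      IsRankedForest (parents d s') (ranks d s') root ∧
      (∀ x, ranks d s x < ranks d s v → parents d s' x = parents d s x) ∧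
      c ≤ 3 * (findCost L (ranks d s v) (ranks d s (root v)) + 1) := by
  have hcard := Fintype.card_fin n
  induction k generalizing v with
  | zero =>
    have := h.rank_lt_card v
    omega
  | succ k ih =>
    simp only [findRoot, run_bind, run_read, run_test, run_ite, run_pure, run_write,
      decide_eq_true_eq]
    change (parents d s v = v → _) ∧ (parents d s v ≠ v → Run _ (findRoot d k (parents d s v)) s _)
    refine ⟨fun hv => ⟨(h.root_eq v hv).symm, h, fun _ _ => trivial, by omega⟩, fun hv => ?_⟩
    have hlt := h.rank_lt v hv
    refine ((ih (v := parents d s v) (by omega)).frame modifies_findRoot).mono ?_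
    rintro r s' c ⟨⟨rfl, h', hparents, hc⟩, hF⟩
    have hranks : ranks d s' = ranks d s := ranks_congr (hF _ (by simp))
    have hv' : parents d s' v = parents d s v := hparents v hlt
    rw [h.root_parent] at hc ⊢
    have hne : parents d s' v ≠ v := hv' ▸ hv
    refine ⟨rfl, ?_, fun x hx => ?_, ?_⟩
    · simpa using h'.compress hne
    · rw [parents_store_link, Function.update_of_ne (by rintro rfl; exact hx.false)]
      exact hparents x (hx.trans hlt)
    · have hdrop := h'.forestPotential_compress_add_le (hcard.trans_le hL) hne
      have hsub := potential_sub_potential (L := L) (s := s')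
        (s' := store s' (.link d) (some v) (root v)) d
      simp only [parents_store_link, ne_eq, reduceCtorEq, not_false_eq_true, ranks_store_of_ne]
        at hsub
      rw [hranks, hv'] at hdrop
      rw [hranks] at hsub
      omega

theorem run_findRoot_of_isRankedForest (hL : n ≤ ack L 1) (v : Fin n)
    (h : IsRankedForest (parents d s) (ranks d s) root) :
    Run (potential L) (findRoot d (n + 1) v) s fun r s' c => (r = root v ∧
      IsRankedForest (parents d s') (ranks d s') root ∧ c ≤ 3 * L + 6) ∧ Frame {.link d} s s' := by
  refine ((run_findRoot hL h (by omega)).mono ?_).frame modifies_findRoot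
  rintro r s' c ⟨hr, h', -, hc⟩
  have := findCost_le L (ranks d s v) (ranks d s (root v))
  exact ⟨hr, h', by omega⟩

/-- The arrays of the disjoint-set structure `d` are consistent, and `σ` maps each item to the
representative of its set. -/
def IsRep (d : DSet) (σ : Fin n → Fin n) (s : Memory n) : Prop :=
  ∃ root, IsRankedForest (parents d s) (ranks d s) root ∧ IsLabelling root (labels d s) σ

theorem IsRep.idem (h : IsRep d σ s) (x : Fin n) : σ (σ x) = σ x :=
  let ⟨_, _, hσ⟩ := h
  hσ.idem x

theorem IsRep.congr (h : IsRep d σ s) (hlink : s' (.link d) = s (.link d))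
    (hrank : s' (.rank d) = s (.rank d)) (hlabel : s' (.label d) = s (.label d)) :
    IsRep d σ s' := by
  unfold IsRep
  rwa [parents_congr hlink, ranks_congr hrank, labels_congr hlabel]

theorem IsRep.frame (h : IsRep d σ s) {A : Set Arr} (hF : Frame A s s')
    (hlink : .link d ∉ A := by simp) (hrank : .rank d ∉ A := by simp)
    (hlabel : .label d ∉ A := by simp) : IsRep d σ s' :=
  h.congr (hF _ hlink) (hF _ hrank) (hF _ hlabel)

/-- The amortized cost of an operation on disjoint sets. -/
def opCost (L : ℕ) : ℤ := 20 * (L + 1)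

theorem le_opCost (L : ℕ) : 20 ≤ opCost L := by
  unfold opCost
  omega

theorem modifies_rep {v : Fin n} : Modifies {.link d} (rep d v) :=
  .bind modifies_findRoot fun _ => .read

theorem run_rep (hL : n ≤ ack L 1) (v : Fin n) (h : IsRep d σ s) :
    Run (potential L) (rep d v) s fun r s' c =>
      (r = σ v ∧ IsRep d σ s' ∧ c ≤ opCost L) ∧ Frame {.link d} s s' := by
  obtain ⟨root, hroot, hσ⟩ := h
  refine Run.frame ?_ modifies_rep
  simp only [rep, run_bind, run_read]
  refine (run_findRoot_of_isRankedForest hL v hroot).mono ?_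
  rintro r s' c ⟨⟨rfl, hroot', hc⟩, hF⟩
  have hlabels : labels d s' = labels d s := labels_congr (hF _ (by simp))
  refine ⟨?_, ⟨root, hroot', hlabels ▸ hσ⟩, by unfold opCost; omega⟩
  rw [hσ.eq_label_root, ← hlabels, labels]

theorem isRep_of_link (hroot : IsRankedForest (parents d s) (ranks d s) root)
    (hσ : IsLabelling root (labels d s) σ) {v h a b : Fin n}
    (hvh : a = root v ∧ b = root h ∨ a = root h ∧ b = root v) (hab : a ≠ b)
    (hr : ranks d s a ≤ ranks d s b)
    (hranks : ranks d s' = if ranks d s a = ranks d s b then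
      Function.update (ranks d s) b (ranks d s b + 1) else ranks d s)
    (hparents : parents d s' = Function.update (parents d s) a b := by simp)
    (hlabels : labels d s' = Function.update (labels d s) b h := by simp)
    (hother : ∀ d' ≠ d, parents d' s' = parents d' s ∧
      ranks d' s' = ranks d' s := by simp +contextual) :
    IsRep d (mergeRep σ v h) s' ∧ potential L s' ≤ potential L s + 3 * L := by
  have hab' : parents d s a = a ∧ parents d s b = b := by
    rcases hvh with ⟨rfl, rfl⟩ | ⟨rfl, rfl⟩ <;> exact ⟨hroot.parent_root _, hroot.parent_root _⟩
  have hsub := potential_sub_potential (L := L) d hother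
  have hlink := forestPotential_link_le L hab'.1 hab'.2 hab hr
  have hmax : Function.update (ranks d s) b (max (ranks d s b) (ranks d s a + 1)) = ranks d s' := by
    rw [hranks]
    split_ifs with heq
    · rw [heq, max_eq_right (Nat.le_succ _)]
    · rw [max_eq_left (by omega), Function.update_eq_self]
  rw [← hparents, hmax] at hlink
  refine ⟨⟨linkRoot root a b, ?_, ?_⟩, by omega⟩
  · rw [hparents, ← hmax]
    exact hroot.link hab hab'.1 hab'.2 hr
  · rw [hlabels]
    refine hσ.merge (fun x => ?_) (hvh.symm.imp And.right And.right)
    rcases hvh with ⟨rfl, rfl⟩ | ⟨rfl, rfl⟩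
    · rfl
    · simp only [linkRoot, or_comm]

theorem modifies_merge {v h : Fin n} :
    Modifies {.link d, .rank d, .label d} (merge d v h) :=
  .bind modifies_findRoot.mono fun _ => .bind modifies_findRoot.mono fun _ =>
    .test .write <| .bind .read fun _ => .bind .read fun _ =>
      .test (.bind .write fun _ => .write) <| .bind .write fun _ => .bind .write fun _ =>
        .test .write .pure

theorem run_merge (hL : n ≤ ack L 1) (v h : Fin n) (hs : IsRep d σ s) :
    Run (potential L) (merge d v h) s fun _ s' c =>
      (IsRep d (mergeRep σ v h) s' ∧ c ≤ opCost L) ∧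
        Frame {.link d, .rank d, .label d} s s' := by
  obtain ⟨root, hroot, hσ⟩ := hs
  refine Run.frame ?_ modifies_merge
  simp only [merge, run_bind]
  refine (run_findRoot_of_isRankedForest hL v hroot).mono ?_
  rintro _ s₁ c₁ ⟨⟨rfl, hroot₁, hc₁⟩, hF₁⟩
  refine (run_findRoot_of_isRankedForest hL h hroot₁).mono ?_
  rintro _ s₂ c₂ ⟨⟨rfl, hroot₂, hc₂⟩, hF₂⟩
  have hσ₂ : IsLabelling root (labels d s₂) σ := by
    rwa [labels_congr (hF₂ _ (by simp)), labels_congr (hF₁ _ (by simp))]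
  have hopCost : opCost L = 20 * (L + 1) := rfl
  simp only [run_bind, run_test, run_ite, run_write, run_read, run_pure, decide_eq_true_eq]
  refine ⟨fun hvh => ⟨⟨root, by simpa using hroot₂, ?_⟩, ?_⟩,
    fun hvh => ⟨fun hr => ?_, fun hr => ⟨fun heq => ?_, fun hne => ?_⟩⟩⟩
  · rw [labels_store_label]
    exact hσ₂.merge (fun x => by split_ifs with hx <;> simp_all) (Or.inr rfl)
  · rw [potential_store _ _ (by simp) (by simp)]
    omega
  · change ranks d s₂ (root h) < ranks d s₂ (root v) at hr
    refine And.imp_right (fun hpot => ?_) <| isRep_of_link (L := L) hroot₂ hσ₂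
      (Or.inr ⟨rfl, rfl⟩) (Ne.symm hvh) hr.le (by simp [hr.ne])
    omega
  · change ranks d s₂ (root v) = ranks d s₂ (root h) at heq
    refine And.imp_right (fun hpot => ?_) <| isRep_of_link (L := L) hroot₂ hσ₂
      (Or.inl ⟨rfl, rfl⟩) hvh heq.le (by rw [if_pos heq]; simp [ranks])
    omega
  · change ranks d s₂ (root v) ≠ ranks d s₂ (root h) at hne
    refine And.imp_right (fun hpot => ?_) <| isRep_of_link (L := L) hroot₂ hσ₂
      (Or.inl ⟨rfl, rfl⟩) hvh (le_of_not_gt hr) (by simp [hne])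
    omega

end DisjointSets

/-! ## The phases of the main loop -/

section Phases

open Finset

variable {n L : ℕ} {s s' : Memory n} {σ σ' : Fin n → Fin n} {h : Fin n}

/-- The sources of the edges into `v` in the current graph, back edges excepted. -/
abbrev preds (s : Memory n) (v : Fin n) : List (Fin n) := s .pred (some v)

/-- The original edges that now target `v`. -/
abbrev outs (s : Memory n) (v : Fin n) : List (Fin n × Fin n) := s .O (some v)

/-- The sources of the back edges into `v`. -/
abbrev backs (s : Memory n) (v : Fin n) : List (Fin n) := s .back (some v)

/-- The cross and forward edges that are stored at `h`. -/
abbrev stored (s : Memory n) (h : Option (Fin n)) : List (Fin n × Fin n) := s .R h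

/-- The size of the data that belong to `v`. -/
def weight (s : Memory n) (v : Fin n) : ℤ := (preds s v).length + (outs s v).length + 1

theorem weight_pos (s : Memory n) (v : Fin n) : 0 < weight s v := by
  unfold weight
  omega

theorem weight_frame {A : Set Arr} (hF : Frame A s s') (hpred : .pred ∉ A := by simp)
    (hO : .O ∉ A := by simp) : weight s' = weight s := by
  funext v
  simp only [weight, preds, outs, hF _ hpred, hF _ hO]

/-! ### Constraints -/

/-- The addition of a scheduling constraint from the exit of the class of `u` to `y`. -/
def pushConstraint (u : Fin n) (y : Elem n) : Prog n Unit := do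
  let r ← rep .scc u
  let x ← read .exit r
  modify .fwd none (fun l => (x, y) :: l)

theorem modifies_pushConstraint {u : Fin n} {y : Elem n} :
    Modifies {.link .scc, .fwd} (pushConstraint u y) :=
  .bind modifies_rep.mono fun _ => .bind .read fun _ => .modify

theorem run_pushConstraint (hL : n ≤ ack L 1) (u : Fin n) (y : Elem n) (hs : IsRep .scc σ s) :
    Run (potential L) (pushConstraint u y) s fun _ s' c =>
      IsRep .scc σ s' ∧ c ≤ opCost L + 3 := by
  simp only [pushConstraint, run_bind]
  refine (run_rep hL u hs).mono ?_
  rintro _ s₁ c₁ ⟨⟨rfl, hs₁, hc₁⟩, -⟩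
  rw [run_read, run_modify_of_ne (by simp) (by simp)]
  exact ⟨hs₁.congr (by simp) (by simp) (by simp), by omega⟩

theorem modifies_addConstraints {lift : Bool} {v : Fin n} :
    Modifies {.link .scc, .fwd} (addConstraints lift v) :=
  .bind .read fun _ => .bind (.forEach fun _ => modifies_pushConstraint) fun _ =>
    .test (.bind .read fun _ => .forEach fun _ => modifies_pushConstraint) .pure

theorem run_addConstraints (hL : n ≤ ack L 1) (lift : Bool) (v : Fin n) (hs : IsRep .scc σ s) :
    Run (potential L) (addConstraints lift v) s fun _ s' c =>
      IsRep .scc σ s' ∧ c ≤ 2 * opCost L * weight s v := by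
  have hK := le_opCost L
  simp only [addConstraints, run_bind, run_read]
  refine (run_forEach_of_const_cost_le (fun _ => IsRep .scc σ) (opCost L + 3)
    (fun _ => modifies_pushConstraint) hs fun e _ _ h _ => run_pushConstraint hL e.1 _ h).mono ?_
  rintro _ s₁ c₁ ⟨hs₁, hF₁, hc₁⟩
  simp only [run_test, run_ite, run_bind, run_read, run_pure, decide_eq_true_eq]
  refine ⟨fun _ => ?_, fun _ => ⟨hs₁, ?_⟩⟩
  · refine (run_forEach_of_const_cost_le (fun _ => IsRep .scc σ) (opCost L + 3)
      (fun _ => modifies_pushConstraint) hs₁ fun u _ _ h _ => run_pushConstraint hL u _ h).mono ?_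
    rintro _ s₂ c₂ ⟨hs₂, -, hc₂⟩
    rw [hF₁ .pred (by simp)] at hc₂
    refine ⟨hs₂, ?_⟩
    unfold weight
    nlinarith
  · unfold weight
    nlinarith

/-! ### Restoring edges -/

theorem modifies_restore {a : Option (Fin n)} :
    Modifies {.link .scc, .pred, .O} (restoreCrossForwardEdges a) :=
  .bind .read fun _ => .forEach fun _ => .bind modifies_rep.mono fun _ =>
    .bind .modify fun _ => .modify

theorem run_restore (hL : n ≤ ack L 1) (a : Option (Fin n)) (hs : IsRep .scc σ s) :
    Run (potential L) (restoreCrossForwardEdges a) s fun _ s' c => IsRep .scc σ s' ∧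
      (∀ x, weight s' x = weight s x + 2 * ((stored s a).map fun e => σ e.2).count x) ∧
      c ≤ 2 * opCost L * ((stored s a).length + 1) := by
  have hK := le_opCost L
  simp only [restoreCrossForwardEdges, run_bind, run_read]
  refine (run_forEach_of_const_cost_le (A := {.link .scc, .pred, .O})
    (fun l s' => IsRep .scc σ s' ∧ ∀ x,
      weight s' x + 2 * (l.map fun e => σ e.2).count x =
        weight s x + 2 * ((stored s a).map fun e => σ e.2).count x) (opCost L + 4)
    (fun _ => .bind modifies_rep.mono fun _ => .bind .modify fun _ => .modify)
    ⟨hs, fun _ => rfl⟩ ?_).mono ?_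
  · rintro ⟨u, v⟩ l s₁ ⟨hs₁, hw₁⟩ -
    simp only [run_bind]
    refine (run_rep hL v hs₁).mono ?_
    rintro _ s₂ c₂ ⟨⟨rfl, hs₂, hc₂⟩, hF₂⟩
    rw [run_modify_of_ne (by simp) (by simp), run_modify_of_ne (by simp) (by simp)]
    refine ⟨⟨hs₂.congr (by simp) (by simp) (by simp), fun x => ?_⟩, by omega⟩
    specialize hw₁ x
    rw [← weight_frame hF₂] at hw₁
    by_cases hx : x = σ v
    · simp only [weight, preds, hx, outs, List.map_cons, List.count_cons_self, ne_eq, reduceCtorEq,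
        not_false_eq_true, store_of_ne, store_apply_self, ↓reduceIte, List.length_cons,
        Nat.cast_add, Nat.cast_one] at hw₁ ⊢
      omega
    · simpa [weight, preds, outs, hx, Ne.symm hx] using hw₁
  · rintro _ s' c ⟨⟨hs', hw⟩, -, hc⟩
    exact ⟨hs', by simpa using hw, by nlinarith⟩

/-! ### Searching -/

/-- The set `N_h` in memory. -/
abbrev nested (s : Memory n) : List (Fin n) := s .N none

/-- The set `W_h` in memory. -/
abbrev worklist (s : Memory n) : List (Fin n) := s .W none

/-- The set `P_h` in memory. -/
abbrev backReps (s : Memory n) : List (Fin n) := s .P none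

/-- The state of the backward search from `h`: the items of `N_h` and `W_h` are distinct marked
representatives other than `h`. -/
structure Searching (h : Fin n) (σ : Fin n → Fin n) (s : Memory n) : Prop where
  isRep : IsRep .scc σ s
  nodup : (nested s ++ worklist s).Nodup
  marked : ∀ x ∈ nested s ++ worklist s, σ x = x ∧ x ≠ h ∧ s .markW (some x) = some h

theorem Searching.frame {A : Set Arr} (hS : Searching h σ s) (hs' : IsRep .scc σ s')
    (hF : Frame A s s') (hN : .N ∉ A := by simp) (hW : .W ∉ A := by simp)
    (hmark : .markW ∉ A := by simp) : Searching h σ s' := by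
  refine ⟨hs', ?_, ?_⟩
  · simpa only [nested, worklist, hF _ hN, hF _ hW] using hS.nodup
  · simpa only [nested, worklist, hF _ hN, hF _ hW, hF _ hmark] using hS.marked

theorem Searching.push (hS : Searching h σ s) {r : Fin n} (hσ : σ r = r) (hrh : r ≠ h)
    (hr : r ∉ nested s ++ worklist s) :
    Searching h σ (store (store s .markW (some r) (some h)) .W none (r :: worklist s)) := by
  have hperm := List.perm_middle (a := r) (l₁ := nested s) (l₂ := worklist s)
  refine ⟨hS.isRep.congr (by simp) (by simp) (by simp), ?_, fun x hx => ?_⟩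
  · simpa [nested, worklist] using hperm.nodup_iff.2 (List.nodup_cons.2 ⟨hr, hS.nodup⟩)
  · have hx : x ∈ r :: (nested s ++ worklist s) :=
      hperm.mem_iff.1 (by simpa [nested, worklist] using hx)
    rcases List.mem_cons.1 hx with rfl | hx
    · exact ⟨hσ, hrh, by simp⟩
    · obtain ⟨hσx, hxh, hmark⟩ := hS.marked x hx
      exact ⟨hσx, hxh, by simp [hmark]⟩

theorem Searching.pop (hS : Searching h σ s) {v : Fin n} {rest : List (Fin n)}
    (hW : worklist s = v :: rest) :
    Searching h σ (store (store s .W none rest) .N none (v :: nested s)) := by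
  have hperm := (List.perm_middle (a := v) (l₁ := nested s) (l₂ := rest)).symm
  obtain ⟨hrep, hnodup, hmark⟩ := hS
  rw [hW] at hnodup hmark
  refine ⟨hrep.congr (by simp) (by simp) (by simp), ?_, fun x hx => ?_⟩
  · simpa [nested, worklist] using hperm.nodup_iff.2 hnodup
  · simpa using hmark x (hperm.mem_iff.1 (by simpa [nested, worklist] using hx))

/-- The body of the inner loop of `searchBackwards`. -/
def visitPred (h p : Fin n) : Prog n Unit := do
  let r ← rep .scc p
  let m ← read .markW r
  if ← test (r ≠ h ∧ m ≠ some h) then do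
    write .markW r (some h)
    modify .W none (fun l => r :: l)
  else
    pure ()

theorem modifies_visitPred {p : Fin n} :
    Modifies {.link .scc, .W, .markW} (visitPred h p) :=
  .bind modifies_rep.mono fun _ => .bind .read fun _ =>
    .test (.bind .write fun _ => .modify) .pure

theorem run_visitPred (hL : n ≤ ack L 1) (p : Fin n) (hS : Searching h σ s) :
    Run (potential L) (visitPred h p) s fun _ s' c =>
      Searching h σ s' ∧ c ≤ opCost L + 5 := by
  simp only [visitPred, run_bind]
  refine (run_rep hL p hS.isRep).mono ?_
  rintro _ s₁ c₁ ⟨⟨rfl, hs₁, hc₁⟩, hF₁⟩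
  replace hS := hS.frame hs₁ hF₁
  simp only [run_read, run_test, run_ite, run_bind, run_pure, decide_eq_true_eq]
  refine ⟨fun hr => ?_, fun _ => ⟨hS, by omega⟩⟩
  rw [run_write_of_ne (by simp) (by simp), run_modify_of_ne (by simp) (by simp)]
  refine ⟨?_, by omega⟩
  simpa using hS.push (hs₁.idem p) hr.1 fun hx => hr.2 (hS.marked _ hx).2.2

theorem modifies_searchBackwards {k : ℕ} :
    Modifies {.link .scc, .N, .W, .markW} (searchBackwards h k) := by
  induction k with
  | zero => exact .diverge
  | succ k ih =>
    refine .bind .read fun w => ?_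
    cases w with
    | nil => exact .pure
    | cons v rest =>
      exact .bind .write fun _ => .bind .modify fun _ => .bind .read fun _ =>
        .bind (.forEach fun _ => modifies_visitPred.mono) fun _ => ih

theorem run_searchBackwards (hL : n ≤ ack L 1) {k : ℕ} (hS : Searching h σ s)
    (hk : n + 1 ≤ k + (nested s).length) :
    Run (potential L) (searchBackwards h k) s fun _ s' c =>
      (Searching h σ s' ∧ (worklist s = [] → nested s' = nested s) ∧
        c + 2 * opCost L * ((nested s).map (weight s)).sum ≤
          2 * opCost L * (((nested s').map (weight s)).sum + 1)) ∧
        Frame {.link .scc, .N, .W, .markW} s s' := by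
  refine Run.frame ?_ modifies_searchBackwards
  have hK := le_opCost L
  induction k generalizing s with
  | zero =>
    have hcard := (List.Nodup.of_append_left hS.nodup).length_le_card
    rw [Fintype.card_fin] at hcard
    omega
  | succ k ih =>
    rw [searchBackwards, run_bind, run_read]
    rcases hW : s .W none with _ | ⟨v, rest⟩
    · exact (run_pure _ _).2 ⟨hS, fun _ => rfl, by linarith⟩
    simp only [run_bind]
    rw [run_write_of_ne (by simp) (by simp), run_modify_of_ne (by simp) (by simp), run_read]
    simp only [ne_eq, reduceCtorEq, not_false_eq_true, store_of_ne]
    refine (run_forEach_of_const_cost_le (fun _ => Searching h σ) (opCost L + 5)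
      (fun _ => modifies_visitPred) (hS.pop hW) fun p _ _ hS' _ => run_visitPred hL p hS').mono ?_
    rintro _ s₁ c₁ ⟨hS₁, hF₁, hc₁⟩
    have hN₁ : nested s₁ = v :: nested s := by simp [nested, hF₁ .N]
    have hw₁ : weight s₁ = weight s := by
      rw [weight_frame hF₁]
      rfl
    refine (ih hS₁ (by rw [hN₁, List.length_cons]; omega)).mono ?_
    rintro _ s₂ c₂ ⟨hS₂, -, hc₂⟩
    rw [hw₁, hN₁, List.map_cons, List.sum_cons] at hc₂
    refine ⟨hS₂, fun h => absurd (hW.symm.trans h) (by simp), ?_⟩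
    have hv : (preds s v).length + 1 ≤ weight s v := by
      unfold weight
      omega
    nlinarith

/-- The body of the loop of `findNestedSCCs`. -/
def visitBack (h p : Fin n) : Prog n Unit := do
  let r ← rep .scc p
  let m ← read .markP r
  if ← test (m ≠ some h) then do
    write .markP r (some h)
    modify .P none (fun l => r :: l)
    if ← test (r ≠ h) then do
      write .markW r (some h)
      modify .W none (fun l => r :: l)
    else
      pure ()
  else
    pure ()

theorem modifies_visitBack {p : Fin n} :
    Modifies {.link .scc, .P, .W, .markP, .markW} (visitBack h p) :=
  .bind modifies_rep.mono fun _ => .bind .read fun _ => .test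
    (.bind .write fun _ => .bind .modify fun _ => .test (.bind .write fun _ => .modify) .pure)
    .pure

/-- The state of the first loop of `findNestedSCCs` for `h`: besides `Searching`, the marks of the
items of `W_h` and the length of `P_h` when `k` back edges remain. -/
structure Collecting (h : Fin n) (σ : Fin n → Fin n) (b k : ℕ) (s : Memory n) : Prop where
  searching : Searching h σ s
  nested_eq : nested s = []
  markP_eq : ∀ x ∈ worklist s, s .markP (some x) = some h
  length_add_le : (backReps s).length + k ≤ b
  worklist_eq : backReps s = [] → worklist s = []

theorem Collecting.frame {A : Set Arr} {b k : ℕ} (hs : Collecting h σ b k s)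
    (hs' : IsRep .scc σ s') (hF : Frame A s s') (hN : .N ∉ A := by simp) (hW : .W ∉ A := by simp)
    (hP : .P ∉ A := by simp) (hmarkW : .markW ∉ A := by simp) (hmarkP : .markP ∉ A := by simp) :
    Collecting h σ b k s' := by
  refine ⟨hs.searching.frame hs' hF hN hW hmarkW, ?_, ?_, ?_, ?_⟩
  · simpa only [nested, hF _ hN] using hs.nested_eq
  · simpa only [worklist, hF _ hW, hF _ hmarkP] using hs.markP_eq
  · simpa only [backReps, hF _ hP] using hs.length_add_le
  · simpa only [worklist, backReps, hF _ hW, hF _ hP] using hs.worklist_eq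

theorem Collecting.pushBackRep {b k : ℕ} (hs : Collecting h σ b (k + 1) s) (r : Fin n) :
    Collecting h σ b k
      (store (store s .markP (some r) (some h)) .P none (r :: backReps s)) := by
  have hlen := hs.length_add_le
  refine ⟨⟨hs.searching.isRep.congr (by simp) (by simp) (by simp), ?_, ?_⟩, ?_, ?_, ?_, ?_⟩
  · simpa [nested, worklist] using hs.searching.nodup
  · simpa [nested, worklist] using hs.searching.marked
  · simpa [nested] using hs.nested_eq
  · simpa [worklist] using fun x hx _ => hs.markP_eq x hx
  · simp only [backReps, store_apply_self, ↓reduceIte, List.length_cons] at hlen ⊢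
    omega
  · simp [backReps]

theorem Collecting.pushWorklist {b k : ℕ} (hs : Collecting h σ b k s) {r : Fin n} (hσ : σ r = r)
    (hrh : r ≠ h) (hr : r ∉ worklist s) (hmark : s .markP (some r) = some h)
    (hP : backReps s ≠ []) : Collecting h σ b k
      (store (store s .markW (some r) (some h)) .W none (r :: worklist s)) := by
  refine ⟨hs.searching.push hσ hrh (by simpa [hs.nested_eq] using hr), ?_, ?_, ?_, ?_⟩
  · simpa [nested] using hs.nested_eq
  · simpa [worklist, hmark] using hs.markP_eq
  · simpa [backReps] using hs.length_add_le
  · exact fun h => absurd h (by simpa [backReps] using hP)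

theorem run_visitBack (hL : n ≤ ack L 1) (p : Fin n) {b k : ℕ} (hs : Collecting h σ b (k + 1) s) :
    Run (potential L) (visitBack h p) s fun _ s' c =>
      Collecting h σ b k s' ∧ c ≤ opCost L + 9 := by
  simp only [visitBack, run_bind]
  refine (run_rep hL p hs.searching.isRep).mono ?_
  rintro _ s₁ c₁ ⟨⟨rfl, hs₁, hc₁⟩, hF₁⟩
  replace hs := hs.frame hs₁ hF₁
  simp only [run_read, run_test, run_ite, run_bind, run_pure, decide_eq_true_eq]
  refine ⟨fun hr => ?_, fun _ => ⟨?_, by omega⟩⟩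
  · rw [run_write_of_ne (by simp) (by simp), run_modify_of_ne (by simp) (by simp)]
    have hpush := hs.pushBackRep (σ p)
    refine ⟨fun hrh => ?_, fun _ => ⟨by simpa using hpush, by omega⟩⟩
    rw [run_write_of_ne (by simp) (by simp), run_modify_of_ne (by simp) (by simp)]
    refine ⟨?_, by omega⟩
    simpa [worklist, backReps] using hpush.pushWorklist (hs₁.idem p) hrh
      (fun hx => hr (hs.markP_eq _ (by simpa [worklist] using hx))) (by simp) (by simp [backReps])
  · exact { hs with length_add_le := by have := hs.length_add_le; omega }

theorem modifies_findNestedSCCs :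
    Modifies {.link .scc, .P, .N, .W, .markP, .markW} (findNestedSCCs h) :=
  .bind .write fun _ => .bind .write fun _ => .bind .write fun _ => .bind .read fun _ =>
    .bind (.forEach fun _ => modifies_visitBack.mono) fun _ => modifies_searchBackwards.mono

theorem run_findNestedSCCs (hL : n ≤ ack L 1) (h : Fin n) (hs : IsRep .scc σ s) :
    Run (potential L) (findNestedSCCs h) s fun _ s' c =>
      (Searching h σ s' ∧ (backReps s').length ≤ (backs s h).length ∧
        (backReps s' = [] → nested s' = []) ∧
        c ≤ 2 * opCost L * (((nested s').map (weight s)).sum + (backs s h).length + 2)) ∧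
        Frame {.link .scc, .P, .N, .W, .markP, .markW} s s' := by
  refine Run.frame ?_ modifies_findNestedSCCs
  have hK := le_opCost L
  rw [findNestedSCCs, run_bind, run_write_of_ne (by simp) (by simp), run_bind,
    run_write_of_ne (by simp) (by simp), run_bind, run_write_of_ne (by simp) (by simp), run_bind,
    run_read, run_bind]
  simp only [ne_eq, reduceCtorEq, not_false_eq_true, store_of_ne]
  have h₀ : Collecting h σ (backs s h).length (backs s h).length
      (store (store (store s .P none []) .N none []) .W none []) := by
    refine ⟨⟨hs.congr (by simp) (by simp) (by simp), ?_, ?_⟩, ?_, ?_, ?_, ?_⟩ <;>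
      simp [nested, worklist, backReps]
  refine (run_forEach_of_const_cost_le
    (fun l => Collecting h σ (backs s h).length l.length) (opCost L + 9)
    (fun _ => modifies_visitBack) h₀ fun p _ _ hs' _ => run_visitBack hL p hs').mono ?_
  rintro _ s₁ c₁ ⟨hs₁, hF₁, hc₁⟩
  refine (run_searchBackwards hL hs₁.searching (by omega)).mono ?_
  rintro _ s₂ c₂ ⟨⟨hS₂, hN₂, hc₂⟩, hF₂⟩
  have hP₂ : backReps s₂ = backReps s₁ := congrFun (hF₂ .P (by simp)) none
  have hw₁ : weight s₁ = weight s := by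
    rw [weight_frame hF₁]
    rfl
  refine ⟨hS₂, ?_, fun hP => ?_, ?_⟩
  · simpa [hP₂] using hs₁.length_add_le
  · rw [hN₂ (hs₁.worklist_eq (hP₂ ▸ hP)), hs₁.nested_eq]
  · rw [hs₁.nested_eq, List.map_nil, List.sum_nil, hw₁] at hc₂
    have : (opCost L + 9 + 1) * (backs s h).length ≤ 2 * opCost L * (backs s h).length := by
      gcongr
      omega
    linarith

end Phases

section MainLoop

open Finset

variable {n L : ℕ} {s s' : Memory n} {σ σ' : Fin n → Fin n} {h : Fin n} {lift : Bool}

/-! ### Constructing the order of a component -/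

/-- The representatives `σ'` arise from `σ` when the classes of the items of `N` are merged into the
class of `h`. -/
structure Absorbs (h : Fin n) (N : List (Fin n)) (σ σ' : Fin n → Fin n) : Prop where
  nodup : N.Nodup
  isRep : ∀ x ∈ N, σ x = x ∧ x ≠ h
  of_isRep : ∀ x, σ' x = x → x = h ∨ σ x = x ∧ x ∉ N

theorem run_forEach_addConstraints (hL : n ≤ ack L 1) (N : List (Fin n)) (hs : IsRep .scc σ s) :
    Run (potential L) (forEach N fun v => addConstraints lift v) s fun _ s' c =>
      IsRep .scc σ s' ∧ Frame {.link .scc, .fwd} s s' ∧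
        c ≤ (N.map fun v => 2 * opCost L * weight s v + 1).sum + 1 :=
  run_forEach_of_cost_le (fun _ => IsRep .scc σ) (fun v => 2 * opCost L * weight s v)
    (fun _ => modifies_addConstraints) hs fun v _ _ hs' hF => by
      simpa only [weight_frame hF] using run_addConstraints hL lift v hs'

theorem run_forEach_merge (hL : n ≤ ack L 1) (h : Fin n) (N : List (Fin n))
    (hs : IsRep .scc σ s) :
    Run (potential L) (forEach N fun v => merge .scc v h) s fun _ s' c =>
      (∃ σ', IsRep .scc σ' s' ∧ ∀ x, σ' x = x → x = h ∨ σ x = x ∧ x ∉ N) ∧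
        c ≤ (opCost L + 1) * N.length + 1 := by
  refine (run_forEach_of_const_cost_le (A := {.link .scc, .rank .scc, .label .scc})
    (fun l s' => ∃ σ', IsRep .scc σ' s' ∧ ∀ x, σ' x = x → x = h ∨ σ x = x ∧ (x ∈ N → x ∈ l))
    (opCost L) (fun _ => modifies_merge) ⟨σ, hs, fun x hx => .inr ⟨hx, id⟩⟩ ?_).mono ?_
  · rintro v l s₁ ⟨σ₁, hs₁, hσ₁⟩ -
    refine (run_merge hL v h hs₁).mono ?_
    rintro _ s₂ c₂ ⟨⟨hs₂, hc₂⟩, -⟩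
    refine ⟨⟨_, hs₂, fun x hx => ?_⟩, hc₂⟩
    rcases eq_or_of_mergeRep_eq_self hx with hxh | ⟨hx, hxv⟩
    · exact .inl hxh
    · exact (hσ₁ x hx).imp_right fun ⟨hx, hxl⟩ =>
        ⟨hx, fun hxN => (List.mem_cons.1 (hxl hxN)).resolve_left hxv⟩
  · rintro _ s' c ⟨⟨σ', hs', hσ'⟩, -, hc⟩
    exact ⟨⟨σ', hs', by simpa using hσ'⟩, hc⟩

theorem modifies_constructWPOForSCC :
    Modifies {.link .scc, .rank .scc, .label .scc, .P, .N, .W, .markP, .markW, .fwd, .bwd, .X,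
      .exit} (constructWPOForSCC lift h) :=
  .bind modifies_findNestedSCCs.mono fun _ => .bind .read fun _ => .bind .read fun _ =>
    .test .pure <| .bind (.forEach fun _ => modifies_addConstraints.mono) fun _ =>
      .bind .modify fun _ => .bind (.forEach fun _ => modifies_pushConstraint.mono) fun _ =>
        .bind .modify fun _ => .bind .write fun _ => .forEach fun _ => modifies_merge.mono

theorem length_le_sum_weight (s : Memory n) (N : List (Fin n)) :
    (N.length : ℤ) ≤ (N.map (weight s)).sum := by
  have := List.sum_le_sum (l := N) (f := fun _ => 1) (g := weight s) fun v _ => weight_pos s v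
  simpa using this

theorem run_constructWPOForSCC (hL : n ≤ ack L 1) (lift : Bool) (h : Fin n)
    (hs : IsRep .scc σ s) :
    Run (potential L) (constructWPOForSCC lift h) s fun _ s' c =>
      ∃ σ' N, IsRep .scc σ' s' ∧ Absorbs h N σ σ' ∧
        c ≤ opCost L * (6 * (N.map (weight s)).sum + 4 * (backs s h).length + 5) := by
  have hK := le_opCost L
  simp only [constructWPOForSCC, run_bind, run_read]
  refine (run_findNestedSCCs hL h hs).mono ?_
  rintro _ s₁ c₁ ⟨⟨hS₁, hP₁, hPN, hc₁⟩, hF₁⟩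
  have hnodup : (nested s₁).Nodup := hS₁.nodup.of_append_left
  have hmem : ∀ x ∈ nested s₁, σ x = x ∧ x ≠ h := fun x hx =>
    (hS₁.marked x (List.mem_append_left _ hx)).imp_right And.left
  have hlen := length_le_sum_weight s (nested s₁)
  have hKN := mul_le_mul_of_nonneg_left hlen (by omega : 0 ≤ opCost L)
  have hKP := mul_le_mul_of_nonneg_left (Nat.cast_le (α := ℤ).2 hP₁) (by omega : 0 ≤ opCost L)
  simp only [run_test, run_ite, run_bind, run_pure, decide_eq_true_eq, List.isEmpty_iff]
  refine ⟨fun hP => ⟨σ, nested s₁, hS₁.isRep, ⟨hnodup, hmem, fun x hx => .inr ⟨hx, ?_⟩⟩, ?_⟩,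
    fun _ => ?_⟩
  · simp [hPN hP]
  · nlinarith
  refine (run_forEach_addConstraints hL (nested s₁) hS₁.isRep).mono ?_
  rintro _ s₂ c₂ ⟨hs₂, -, hc₂⟩
  rw [run_modify_of_ne (by simp) (by simp)]
  refine (run_forEach_of_const_cost_le (l := backReps s₁) (fun _ => IsRep .scc σ) (opCost L + 3)
    (fun _ => modifies_pushConstraint) (hs₂.congr (by simp) (by simp) (by simp))
    fun p _ _ hs' _ => run_pushConstraint hL p _ hs').mono ?_
  rintro _ s₃ c₃ ⟨hs₃, -, hc₃⟩
  rw [run_modify_of_ne (by simp) (by simp), run_write_of_ne (by simp) (by simp)]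
  refine (run_forEach_merge hL h (nested s₁) (hs₃.congr (by simp) (by simp) (by simp))).mono ?_
  rintro _ s₄ c₄ ⟨⟨σ₄, hs₄, hσ₄⟩, hc₄⟩
  refine ⟨σ₄, nested s₁, hs₄, ⟨hnodup, hmem, hσ₄⟩, ?_⟩
  rw [weight_frame hF₁, List.sum_map_add, List.sum_map_mul_left, List.map_const',
    List.sum_replicate, nsmul_eq_mul, mul_one] at hc₂
  nlinarith

/-! ### The main loop -/

/-- The number of times that the data of `v` may still be traversed when the vertices in `vs`
remain: once if `v` represents its class, and once more if `v` is still to be processed, since it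
may then become a representative again. -/
def credit (σ : Fin n → Fin n) (vs : List (Fin n)) (v : Fin n) : ℤ :=
  (if σ v = v then 1 else 0) + if v ∈ vs then 1 else 0

theorem credit_nonneg (σ : Fin n → Fin n) (vs : List (Fin n)) (v : Fin n) : 0 ≤ credit σ vs v := by
  unfold credit
  split_ifs <;> omega

theorem credit_le_two (σ : Fin n → Fin n) (vs : List (Fin n)) (v : Fin n) :
    credit σ vs v ≤ 2 := by
  unfold credit
  split_ifs <;> omega

theorem Absorbs.credit_add_le {N l : List (Fin n)} (hA : Absorbs h N σ σ') (hl : h ∉ l)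
    (v : Fin n) : credit σ' l v + (if v ∈ N then 1 else 0) ≤ credit σ (h :: l) v := by
  have hN := hA.isRep v
  have hσ' := hA.of_isRep v
  unfold credit
  by_cases hv : v = h
  · subst hv
    rw [if_neg hl, if_neg fun hvN => (hN hvN).2 rfl, if_pos List.mem_cons_self]
    split_ifs <;> omega
  · simp only [List.mem_cons, hv, false_or] at hσ' ⊢
    split_ifs <;> simp_all

/-- The total size of the traversals that may still follow when the vertices in `vs` remain. -/
def pendingWork (σ : Fin n → Fin n) (vs : List (Fin n)) (s : Memory n) : ℤ :=
  ∑ v, credit σ vs v * weight s v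

theorem pendingWork_le (σ : Fin n → Fin n) (vs : List (Fin n)) (s : Memory n) :
    pendingWork σ vs s ≤ 2 * ∑ v, weight s v := by
  rw [pendingWork, mul_sum]
  exact sum_le_sum fun v _ => mul_le_mul_of_nonneg_right (credit_le_two σ vs v) (weight_pos s v).le

theorem pendingWork_le_of_restore {vs l : List (Fin n)}
    (hw : ∀ x, weight s' x = weight s x + 2 * l.count x) :
    pendingWork σ vs s' ≤ pendingWork σ vs s + 4 * l.length := by
  have hcount : ∑ x, (l.count x : ℤ) = l.length := by
    have := Multiset.sum_count_eq_card (s := univ) (m := (l : Multiset (Fin n))) (by simp)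
    simp only [Multiset.coe_count, Multiset.coe_card] at this
    exact_mod_cast this
  calc pendingWork σ vs s'
      = pendingWork σ vs s + 2 * ∑ x, credit σ vs x * l.count x := by
        rw [pendingWork, pendingWork, mul_sum, ← sum_add_distrib]
        exact sum_congr rfl fun x _ => by rw [hw]; ring
    _ ≤ pendingWork σ vs s + 2 * ∑ x, 2 * (l.count x : ℤ) := by
        gcongr with x
        exact credit_le_two σ vs x
    _ = pendingWork σ vs s + 4 * l.length := by
        rw [← mul_sum, hcount]
        ring

theorem Absorbs.pendingWork_add_le {N l : List (Fin n)} (hA : Absorbs h N σ σ') (hl : h ∉ l)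
    (s : Memory n) :
    pendingWork σ' l s + (N.map (weight s)).sum ≤ pendingWork σ (h :: l) s := by
  have hsum : (N.map (weight s)).sum = ∑ v, if v ∈ N then weight s v else 0 := by
    simp_rw [← List.mem_toFinset]
    rw [sum_ite_mem, univ_inter, List.sum_toFinset _ hA.nodup]
  rw [hsum, pendingWork, pendingWork, ← sum_add_distrib]
  refine sum_le_sum fun v _ => ?_
  calc credit σ' l v * weight s v + (if v ∈ N then weight s v else 0)
      = (credit σ' l v + if v ∈ N then 1 else 0) * weight s v := by
        rw [add_mul, ite_mul, one_mul, zero_mul]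
    _ ≤ credit σ (h :: l) v * weight s v :=
        mul_le_mul_of_nonneg_right (hA.credit_add_le hl v) (weight_pos s v).le

/-- The body of the main loop. -/
def processVertex (lift : Bool) (h : Fin n) : Prog n Unit := do
  restoreCrossForwardEdges (some h)
  constructWPOForSCC lift h

theorem modifies_processVertex :
    Modifies {a | a ≠ .R ∧ a ≠ .back} (processVertex lift h) :=
  .bind modifies_restore.mono fun _ => modifies_constructWPOForSCC.mono

theorem run_processVertex (hL : n ≤ ack L 1) (lift : Bool) {l : List (Fin n)} (hl : h ∉ l)
    (hs : IsRep .scc σ s) :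
    Run (potential L) (processVertex lift h) s fun _ s' c => ∃ σ', IsRep .scc σ' s' ∧
      c + 6 * opCost L * pendingWork σ' l s' ≤ 6 * opCost L * pendingWork σ (h :: l) s +
        26 * opCost L * ((backs s h).length + (stored s (some h)).length + 1) := by
  have hK := le_opCost L
  rw [processVertex, run_bind]
  refine ((run_restore hL (some h) hs).frame modifies_restore).mono ?_
  rintro _ s₁ c₁ ⟨⟨hs₁, hw₁, hc₁⟩, hF₁⟩
  refine ((run_constructWPOForSCC hL lift h hs₁).frame modifies_constructWPOForSCC).mono ?_
  rintro _ s₂ c₂ ⟨⟨σ₂, N, hs₂, hA, hc₂⟩, hF₂⟩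
  refine ⟨σ₂, hs₂, ?_⟩
  have hback : backs s₁ h = backs s h := congrFun (hF₁ .back (by simp)) _
  have hpending₂ : pendingWork σ₂ l s₂ = pendingWork σ₂ l s₁ := by
    simp only [pendingWork, weight_frame hF₂]
  have hrestore := pendingWork_le_of_restore (σ := σ) (vs := h :: l) hw₁
  rw [List.length_map] at hrestore
  have hpending := mul_le_mul_of_nonneg_left ((hA.pendingWork_add_le hl s₁).trans hrestore)
    (by omega : 0 ≤ opCost L)
  rw [hback] at hc₂
  rw [hpending₂]
  nlinarith

theorem run_mainLoop (hL : n ≤ ack L 1) (lift : Bool) {vs : List (Fin n)} (hvs : vs.Nodup)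
    (hs : IsRep .scc σ s) :
    Run (potential L) (forEach vs (processVertex lift)) s fun _ s' c =>
      (∃ σ', IsRep .scc σ' s' ∧
        c + 6 * opCost L * pendingWork σ' [] s' ≤ 6 * opCost L * pendingWork σ vs s + 1 +
          27 * opCost L *
            (vs.map fun v => ((backs s v).length + (stored s (some v)).length + 1 : ℤ)).sum) ∧
      Frame {a | a ≠ .R ∧ a ≠ .back} s s' := by
  refine Run.frame ?_ (.forEach fun _ => modifies_processVertex)
  have hK := le_opCost L
  refine (run_forEach (fun l s' c => l.Nodup ∧ Frame {a | a ≠ .R ∧ a ≠ .back} s s' ∧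
    ∃ σ', IsRep .scc σ' s' ∧ c + 6 * opCost L * pendingWork σ' l s' + 27 * opCost L *
        (l.map fun v => ((backs s v).length + (stored s (some v)).length + 1 : ℤ)).sum ≤
      6 * opCost L * pendingWork σ vs s + 27 * opCost L *
        (vs.map fun v => ((backs s v).length + (stored s (some v)).length + 1 : ℤ)).sum)
    ⟨hvs, .refl _ s, σ, hs, by omega⟩ ?_).mono ?_
  · rintro h l s₁ c₁ ⟨hl, hF₁, σ₁, hs₁, hc₁⟩
    obtain ⟨hhl, hl⟩ := List.nodup_cons.1 hl
    refine ((run_processVertex hL lift hhl hs₁).frame modifies_processVertex).mono ?_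
    rintro _ s₂ c₂ ⟨⟨σ₂, hs₂, hc₂⟩, hF₂⟩
    refine ⟨hl, hF₁.trans hF₂ le_rfl, σ₂, hs₂, ?_⟩
    rw [backs, stored, hF₁ .back (by simp), hF₁ .R (by simp)] at hc₂
    rw [List.map_cons, List.sum_cons] at hc₁
    nlinarith
  · rintro _ s' c ⟨-, -, σ', hs', hc⟩
    rw [List.map_nil, List.sum_nil] at hc
    exact ⟨σ', hs', by linarith⟩

theorem run_connectWPOsOfMaximalSCCs (hL : n ≤ ack L 1) (lift : Bool) (hs : IsRep .scc σ s) :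
    Run (potential L) (connectWPOsOfMaximalSCCs lift) s fun _ _ c =>
      c ≤ 2 * opCost L * (pendingWork σ [] s + n + 1) := by
  have hK := le_opCost L
  refine (run_forEach_of_cost_le (A := {.link .scc, .fwd}) (fun _ => IsRep .scc σ)
    (fun v => 2 * opCost L * (credit σ [] v * weight s v) + (opCost L + 1)) (fun v => ?_) hs
    ?_).mono ?_
  · exact .bind modifies_rep.mono fun _ => .test modifies_addConstraints .pure
  · intro v _ s₁ hs₁ hF₁
    simp only [run_bind]
    refine (run_rep hL v hs₁).mono ?_
    rintro _ s₂ c₂ ⟨⟨rfl, hs₂, hc₂⟩, hF₂⟩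
    simp only [run_test, run_ite, run_pure, decide_eq_true_eq]
    refine ⟨fun hv => (run_addConstraints hL lift v hs₂).mono ?_, fun hv => ⟨hs₂, ?_⟩⟩
    · rintro _ s₃ c₃ ⟨hs₃, hc₃⟩
      rw [weight_frame hF₂, weight_frame hF₁] at hc₃
      simp only [credit, hv, if_true, List.not_mem_nil, if_false, add_zero, one_mul]
      exact ⟨hs₃, by linarith⟩
    · simp only [credit, hv, if_false, List.not_mem_nil, add_zero, zero_mul, mul_zero]
      linarith
  · rintro _ s' c ⟨-, -, hc⟩
    simp only [List.sum_map_add, List.sum_map_mul_left, ← Fin.sum_univ_def, sum_const, card_univ,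
      Fintype.card_fin, nsmul_eq_mul] at hc
    unfold pendingWork
    nlinarith

end MainLoop

/-! ## Depth-first forests -/

section Forests

variable {V : Type}

/-- The vertices of a forest, in preorder. -/
def Forest.verts : Forest V → List V
  | .nil => []
  | .node r children siblings => r :: (children.verts ++ siblings.verts)

variable {E : V → V → Prop} {cand S S' : Set V} {F : Forest V}

theorem DFS.mem_iff (h : DFS E cand S F S') (x : V) : x ∈ S' ↔ x ∈ S ∨ x ∈ F.verts := by
  induction h with
  | done => simp [Forest.verts]
  | visit _ _ _ _ ih₁ ih₂ =>
    simp only [ih₂, ih₁, Forest.verts, Set.mem_insert_iff, List.mem_cons, List.mem_append]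
    tauto

theorem DFS.notMem_of_mem_verts (h : DFS E cand S F S') {x : V} (hx : x ∈ F.verts) : x ∉ S := by
  induction h with
  | done => simp [Forest.verts] at hx
  | visit _ hr h₁ _ ih₁ ih₂ =>
    rcases List.mem_cons.1 hx with rfl | hx
    · exact hr
    rcases List.mem_append.1 hx with hx | hx
    · exact fun hxS => ih₁ hx (Set.mem_insert_of_mem _ hxS)
    · exact fun hxS => ih₂ hx ((h₁.mem_iff x).2 (.inl (Set.mem_insert_of_mem _ hxS)))

theorem DFS.nodup_verts (h : DFS E cand S F S') : F.verts.Nodup := by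
  induction h with
  | done => exact List.nodup_nil
  | visit _ hr h₁ h₂ ih₁ ih₂ =>
    rw [Forest.verts, List.nodup_cons, List.nodup_append']
    refine ⟨fun hmem => ?_, ih₁, ih₂, fun x hx₁ hx₂ => ?_⟩
    · rcases List.mem_append.1 hmem with hr₁ | hr₂
      · exact h₁.notMem_of_mem_verts hr₁ (Set.mem_insert _ _)
      · exact h₂.notMem_of_mem_verts hr₂ ((h₁.mem_iff _).2 (.inl (Set.mem_insert _ _)))
    · exact h₂.notMem_of_mem_verts hx₂ ((h₁.mem_iff x).2 (.inr hx₁))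

end Forests

/-! ## The preparatory phases -/

section Preparation

open Finset

variable {n L : ℕ} {s s' : Memory n} {σ : Fin n → Fin n}

theorem sum_length_ite_cons {ι γ : Type*} [Fintype ι] [DecidableEq ι] (f : ι → List γ) (a : ι)
    (x : γ) : ∑ i, ((if i = a then x :: f a else f i).length : ℤ) =
      ∑ i, ((f i).length : ℤ) + 1 := by
  have hlength (i : ι) : ((if i = a then x :: f a else f i).length : ℤ) =
      (f i).length + if i = a then 1 else 0 := by
    split_ifs with hi <;> simp [hi]
  simp only [hlength, sum_add_distrib, sum_ite_eq', mem_univ, if_true]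

/-! ### Initialization -/

theorem modifies_tabulate {F : Forest (Fin n)} {p : Option (Fin n)} :
    Modifies {.dfn, .post, .parent, .clock, .order} (tabulate F p) := by
  induction F generalizing p with
  | nil => exact .tick
  | node r children siblings ih₁ ih₂ =>
    exact .bind .read fun _ => .bind .write fun _ => .bind .write fun _ => .bind .write fun _ =>
      .bind .modify fun _ => .bind ih₁ fun _ => .bind .read fun _ => .bind .write fun _ =>
        .bind .write fun _ => ih₂

theorem run_tabulate (F : Forest (Fin n)) (p : Option (Fin n)) (s : Memory n) :
    Run 0 (tabulate F p) s fun _ s' t =>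
      s' .order none = F.verts.reverse ++ (s .order none : List (Fin n)) ∧
        t = 10 * F.verts.length + 1 := by
  induction F generalizing p s with
  | nil =>
    rw [tabulate, run_tick]
    exact ⟨rfl, rfl⟩
  | node r children siblings ih₁ ih₂ =>
    simp only [tabulate, run_bind, run_read, run_write, run_modify, Pi.zero_apply, add_zero,
      sub_zero]
    refine (ih₁ _ _).mono ?_
    rintro _ s₁ c₁ ⟨horder₁, rfl⟩
    refine (ih₂ _ _).mono ?_
    rintro _ s₂ c₂ ⟨horder₂, rfl⟩
    refine ⟨?_, ?_⟩
    · simp [horder₂, horder₁, Forest.verts]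
    · simp only [Forest.verts, List.length_cons, List.length_append]
      push_cast
      ring

/-- The initialization of the cells of `v`. -/
def initVertex (v : Fin n) : Prog n Unit := do
  makeSet .scc v
  makeSet .anc v
  write .exit v (Elem.vtx v)
  write .R v []
  write .O v []
  write .back v []
  write .pred v []
  write .query v []
  write .markP v none
  write .markW v none

/-- The edges that `removeAllCrossForwardEdges` attaches to `v`. -/
abbrev queries (s : Memory n) (v : Fin n) : List (Fin n × (Fin n × Fin n)) := s .query (some v)

/-- The cells of `v` are in their initial state. -/
structure IsInit (s : Memory n) (v : Fin n) : Prop where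
  parents_eq : ∀ d, parents d s v = v
  ranks_eq : ∀ d, ranks d s v = 0
  labels_eq : ∀ d, labels d s v = v
  backs_eq : backs s v = []
  preds_eq : preds s v = []
  outs_eq : outs s v = []
  stored_eq : stored s (some v) = []
  queries_eq : queries s v = []

theorem IsInit.congr {v : Fin n} (h : IsInit s v) (hs' : ∀ a, s' a (some v) = s a (some v)) :
    IsInit s' v := by
  constructor <;> simp only [parents, ranks, labels, backs, preds, outs, stored, queries, hs']
  exacts [h.parents_eq, h.ranks_eq, h.labels_eq, h.backs_eq, h.preds_eq, h.outs_eq, h.stored_eq,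
    h.queries_eq]

theorem isRep_of_isInit (h : ∀ v, IsInit s v) (d : DSet) : IsRep d id s := by
  have hparents : parents d s = id := funext fun v => (h v).parents_eq d
  have hranks : ranks d s = fun _ => 0 := funext fun v => (h v).ranks_eq d
  have hlabels : labels d s = id := funext fun v => (h v).labels_eq d
  refine ⟨id, ?_, ?_⟩
  · rw [hparents, hranks]
    exact isRankedForest_id
  · rw [hlabels]
    exact ⟨fun _ => rfl, fun _ => rfl⟩

theorem potential_eq_zero_of_isInit (h : ∀ v, IsInit s v) : potential L s = 0 := by
  simp [potential, forestPotential, nodePotential, (h _).ranks_eq]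

theorem run_initVertex (v : Fin n) (s : Memory n) :
    Run 0 (initVertex v) s fun _ s' t =>
      IsInit s' v ∧ (∀ a, ∀ i ≠ some v, s' a i = s a i) ∧ t = 14 := by
  simp only [initVertex, makeSet, run_bind, run_write, Pi.zero_apply, add_zero, sub_zero]
  refine ⟨?_, fun a i hi => by simp only [store_apply_of_ne hi], by norm_num⟩
  constructor <;> (try rintro (_ | _)) <;>
    simp [parents, ranks, labels, backs, preds, outs, stored, queries]

theorem run_setup (D : Forest (Fin n)) (s : Memory n) :
    Run 0 (setup D) s fun _ s' t => (∀ v, IsInit s' v) ∧ stored s' none = [] ∧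
      s' .cross none = [] ∧ s' .order none = D.verts.reverse ∧
      t ≤ 10 * D.verts.length + 15 * n + 9 := by
  simp only [setup, run_bind, run_write, Pi.zero_apply, add_zero, sub_zero]
  refine ((run_tabulate D none _).frame modifies_tabulate).mono ?_
  rintro _ s₁ _ ⟨⟨horder, rfl⟩, hF⟩
  refine (run_forEach_of_const_cost_le (f := initVertex)
    (fun l s' => (∀ v ∉ l, IsInit s' v) ∧ ∀ a, s' a none = s₁ a none) 14 (fun _ => .univ)
    ⟨fun v hv => absurd (List.mem_finRange v) hv, fun _ => rfl⟩ ?_).mono ?_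
  · rintro v l s' ⟨hinit, hnone⟩ -
    refine (run_initVertex v s').mono ?_
    rintro _ s'' _ ⟨hv, hs'', rfl⟩
    refine ⟨⟨fun x hx => ?_, fun a => (hs'' a none nofun).trans (hnone a)⟩, le_rfl⟩
    by_cases hxv : x = v
    · exact hxv ▸ hv
    · exact (hinit x (by simp [hxv, hx])).congr fun a => hs'' a _ (by simpa using hxv)
  · rintro _ s' c ⟨⟨hinit, hnone⟩, -, hc⟩
    rw [List.length_finRange] at hc
    refine ⟨fun v => hinit v List.not_mem_nil, ?_, ?_, ?_, by linarith⟩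
    · simp [stored, hnone, hF .R]
    · simp [hnone, hF .cross]
    · simpa [hnone] using horder

/-! ### Classification of the edges -/

/-- The cross and forward edges. -/
abbrev crossing (s : Memory n) : List (Fin n × Fin n) := s .cross none

/-- The size of the result of `classifyEdges`. Each cross or forward edge counts twice, like a tree
edge, which enters `pred` and `O`. -/
def classifiedSize (s : Memory n) : ℤ :=
  ∑ v, ((backs s v).length + weight s v) + 2 * (crossing s).length

theorem modifies_classifyEdges {E : List (Fin n × Fin n)} :
    Modifies {.back, .pred, .O, .cross} (classifyEdges E) :=
  .forEach fun _ => .bind .read fun _ => .bind .read fun _ => .bind .read fun _ =>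
    .bind .read fun _ => .test .modify <| .bind .read fun _ =>
      .test (.bind .modify fun _ => .modify) .modify

theorem classifiedSize_store_back (s : Memory n) (u v : Fin n) :
    classifiedSize (store s .back (some v) (u :: backs s v)) = classifiedSize s + 1 := by
  simp only [classifiedSize, weight, backs, preds, outs, crossing, sum_add_distrib,
    store_apply_self, Option.some_inj, sum_length_ite_cons (backs s), ne_eq, reduceCtorEq,
    not_false_eq_true, store_of_ne]
  ring

theorem classifiedSize_store_pred_store_O (s : Memory n) (u v : Fin n) (e : Fin n × Fin n) :
    classifiedSize (store (store s .pred (some v) (u :: preds s v)) .O (some v) (e :: outs s v)) =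
      classifiedSize s + 2 := by
  simp only [classifiedSize, weight, backs, preds, outs, crossing, sum_add_distrib,
    store_apply_self, Option.some_inj, sum_length_ite_cons (preds s),
    sum_length_ite_cons (outs s), ne_eq, reduceCtorEq, not_false_eq_true, store_of_ne]
  ring

theorem classifiedSize_store_cross (s : Memory n) (e : Fin n × Fin n) :
    classifiedSize (store s .cross none (e :: crossing s)) = classifiedSize s + 2 := by
  simp only [classifiedSize, weight, backs, preds, outs, crossing, store_apply_self, if_true,
    List.length_cons, ne_eq, reduceCtorEq, not_false_eq_true, store_of_ne]
  push_cast
  ring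

theorem run_classifyEdges (E : List (Fin n × Fin n)) (s : Memory n) :
    Run (potential L) (classifyEdges E) s fun _ s' c =>
      (classifiedSize s' ≤ classifiedSize s + 2 * E.length ∧ c ≤ 12 * E.length + 1) ∧
        Frame {.back, .pred, .O, .cross} s s' := by
  refine Run.frame ?_ modifies_classifyEdges
  refine (run_forEach_of_const_cost_le (A := {.back, .pred, .O, .cross}) (fun l s' =>
      classifiedSize s' + 2 * l.length ≤ classifiedSize s + 2 * E.length) 11
    (fun _ => .bind .read fun _ => .bind .read fun _ => .bind .read fun _ => .bind .read fun _ =>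
      .test .modify <| .bind .read fun _ => .test (.bind .modify fun _ => .modify) .modify)
    le_rfl ?_).mono ?_
  · rintro ⟨u, v⟩ l s₁ h₁ -
    rw [List.length_cons, Nat.cast_succ] at h₁
    simp only [run_bind, run_read, run_test, run_ite, decide_eq_true_eq]
    refine ⟨fun _ => ?_, fun _ => ⟨fun _ => ?_, fun _ => ?_⟩⟩
    · rw [run_modify_of_ne (by simp) (by simp), classifiedSize_store_back]
      omega
    · rw [run_modify_of_ne (by simp) (by simp), run_modify_of_ne (by simp) (by simp)]
      simp only [ne_eq, reduceCtorEq, not_false_eq_true, store_of_ne]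
      rw [classifiedSize_store_pred_store_O]
      omega
    · rw [run_modify_of_ne (by simp) (by simp), classifiedSize_store_cross]
      omega
  · rintro _ s' c ⟨hsize, -, hc⟩
    rw [List.length_nil, Nat.cast_zero, mul_zero, add_zero] at hsize
    exact ⟨hsize, by linarith⟩

/-! ### Removal of the cross and forward edges -/

/-- The total length of the lists of queries. -/
def numQueries (s : Memory n) : ℤ := ∑ v, (queries s v).length

/-- The number of cross and forward edges that are stored for restoring. -/
def numStored (s : Memory n) : ℤ := ∑ h, (stored s h).length

theorem numQueries_store_query (s : Memory n) (v : Fin n) (q : Fin n × (Fin n × Fin n)) :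
    numQueries (store s .query (some v) (q :: queries s v)) = numQueries s + 1 := by
  simpa only [numQueries, store_apply_self, Option.some_inj] using
    sum_length_ite_cons (queries s) v q

theorem numStored_store_R (s : Memory n) (h : Option (Fin n)) (e : Fin n × Fin n) :
    numStored (store s .R h (e :: stored s h)) = numStored s + 1 := by
  simpa only [numStored, stored, store_apply_self] using
    sum_length_ite_cons (stored s) h e

/-- The assignment of a cross or forward edge to its endpoint of smaller number. -/
def storeQuery (e : Fin n × Fin n) : Prog n Unit := do
  let du ← read .dfn e.1
  let dv ← read .dfn e.2
  if ← test (du < dv) then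
    modify .query e.1 (fun l => (e.2, e) :: l)
  else
    modify .query e.2 (fun l => (e.1, e) :: l)

theorem run_forEach_storeQuery (es : List (Fin n × Fin n)) (s : Memory n) :
    Run (potential L) (forEach es storeQuery) s fun _ s' c =>
      numQueries s' = numQueries s + es.length ∧ Frame {.query} s s' ∧ c ≤ 6 * es.length + 1 := by
  refine (run_forEach_of_const_cost_le (A := {.query})
    (fun l s' => numQueries s' + l.length = numQueries s + es.length) 5
    (fun _ => .bind .read fun _ => .bind .read fun _ => .test .modify .modify) rfl ?_).mono ?_
  · rintro ⟨u, v⟩ l s₁ h₁ -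
    rw [List.length_cons, Nat.cast_succ] at h₁
    simp only [run_bind, run_read, run_test, run_ite, decide_eq_true_eq]
    refine ⟨fun _ => ?_, fun _ => ?_⟩ <;>
    · rw [run_modify_of_ne (by simp) (by simp), numQueries_store_query]
      exact ⟨by linarith, by norm_num⟩
  · rintro _ s' c ⟨hsize, hF, hc⟩
    exact ⟨by simpa using hsize, hF, by linarith⟩

/-- The storage of an edge at the lowest common ancestor of its endpoints when the endpoint `w` is
processed. -/
def answerQuery (w : Fin n) (q : Fin n × (Fin n × Fin n)) : Prog n Unit := do
  let a ← rep .anc q.1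
  let da ← read .dfn a
  let dw ← read .dfn w
  if ← test (da ≤ dw) then
    modify .R (some a) (fun l => q.2 :: l)
  else
    modify .R none (fun l => q.2 :: l)

theorem modifies_answerQuery {w : Fin n} {q : Fin n × (Fin n × Fin n)} :
    Modifies {.link .anc, .R} (answerQuery w q) :=
  .bind modifies_rep.mono fun _ => .bind .read fun _ => .bind .read fun _ => .test .modify .modify

theorem run_answerQuery (hL : n ≤ ack L 1) (w : Fin n) (q : Fin n × (Fin n × Fin n))
    (hs : IsRep .anc σ s) :
    Run (potential L) (answerQuery w q) s fun _ s' c =>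
      IsRep .anc σ s' ∧ numStored s' = numStored s + 1 ∧ c ≤ opCost L + 5 := by
  simp only [answerQuery, run_bind]
  refine (run_rep hL q.1 hs).mono ?_
  rintro _ s₁ c₁ ⟨⟨rfl, hs₁, hc₁⟩, hF₁⟩
  have hstored : numStored s₁ = numStored s := by
    simp only [numStored, stored, hF₁ .R (by simp)]
  simp only [run_read, run_test, run_ite, decide_eq_true_eq]
  refine ⟨fun _ => ?_, fun _ => ?_⟩ <;>
  · rw [run_modify_of_ne (by simp) (by simp), numStored_store_R, hstored]
    exact ⟨hs₁.congr (by simp) (by simp) (by simp), rfl, by linarith⟩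

/-- The processing of `w` in the computation of the lowest common ancestors. -/
def answerQueries (w : Fin n) : Prog n Unit := do
  let qs ← read .query w
  forEach qs (answerQuery w)
  let p ← read .parent w
  match p with
  | none => pure ()
  | some p => merge .anc w p

theorem modifies_answerQueries {w : Fin n} :
    Modifies {.link .anc, .rank .anc, .label .anc, .R} (answerQueries w) :=
  .bind .read fun _ => .bind (.forEach fun _ => modifies_answerQuery.mono) fun _ =>
    .bind .read fun p => by
      cases p with
      | none => exact .pure
      | some p => exact modifies_merge.mono

theorem run_answerQueries (hL : n ≤ ack L 1) (w : Fin n) (hs : IsRep .anc σ s) :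
    Run (potential L) (answerQueries w) s fun _ s' c => (∃ σ', IsRep .anc σ' s') ∧
      numStored s' = numStored s + (queries s w).length ∧
      c ≤ 2 * opCost L * ((queries s w).length + 1) := by
  have hK := le_opCost L
  simp only [answerQueries, run_bind, run_read]
  refine (run_forEach_of_const_cost_le (fun l s' => IsRep .anc σ s' ∧
      numStored s' + l.length = numStored s + (queries s w).length) (opCost L + 5)
    (fun _ => modifies_answerQuery) ⟨hs, rfl⟩ ?_).mono ?_
  · rintro q l s₁ ⟨hs₁, hn₁⟩ -
    rw [List.length_cons, Nat.cast_succ] at hn₁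
    refine (run_answerQuery hL w q hs₁).mono ?_
    rintro _ s₂ c₂ ⟨hs₂, hn₂, hc₂⟩
    exact ⟨⟨hs₂, by linarith⟩, hc₂⟩
  · rintro _ s₁ c₁ ⟨⟨hs₁, hn₁⟩, -, hc₁⟩
    rw [List.length_nil, Nat.cast_zero, add_zero] at hn₁
    rcases s₁ .parent (some w) with _ | p
    · rw [run_pure]
      exact ⟨⟨σ, hs₁⟩, hn₁, by nlinarith⟩
    · refine ((run_merge hL w p hs₁)).mono ?_
      rintro _ s₂ c₂ ⟨⟨hs₂, hc₂⟩, hF₂⟩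
      have hn₂ : numStored s₂ = numStored s₁ := by
        simp only [numStored, stored, hF₂ .R (by simp)]
      exact ⟨⟨_, hs₂⟩, hn₂.trans hn₁, by nlinarith⟩

theorem run_forEach_answerQueries (hL : n ≤ ack L 1) {vs : List (Fin n)} (hvs : vs.Nodup)
    (hs : IsRep .anc σ s) :
    Run (potential L) (forEach vs answerQueries) s fun _ s' c =>
      numStored s' ≤ numStored s + numQueries s ∧
      Frame {.link .anc, .rank .anc, .label .anc, .R} s s' ∧
        c ≤ 3 * opCost L * (numQueries s + n) + 1 := by
  have hK := le_opCost L
  refine (run_forEach_of_cost_le (fun l s' => (∃ σ', IsRep .anc σ' s') ∧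
      numStored s' + (l.map fun w => ((queries s w).length : ℤ)).sum =
        numStored s + (vs.map fun w => ((queries s w).length : ℤ)).sum)
    (fun w => 2 * opCost L * ((queries s w).length + 1)) (fun _ => modifies_answerQueries)
    ⟨⟨σ, hs⟩, rfl⟩ ?_).mono ?_
  · rintro w l s₁ ⟨⟨σ₁, hs₁⟩, hn₁⟩ hF₁
    have hq : queries s₁ w = queries s w := congrFun (hF₁ .query (by simp)) _
    rw [List.map_cons, List.sum_cons] at hn₁
    refine (run_answerQueries hL w hs₁).mono ?_
    rintro _ s₂ c₂ ⟨hs₂, hn₂, hc₂⟩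
    rw [hq] at hn₂ hc₂
    exact ⟨⟨hs₂, by linarith⟩, hc₂⟩
  · rintro _ s' c ⟨⟨-, hn⟩, hF, hc⟩
    have hqs : (vs.map fun w => ((queries s w).length : ℤ)).sum ≤ numQueries s := by
      rw [← List.sum_toFinset _ hvs]
      exact sum_le_univ_sum_of_nonneg fun _ => by positivity
    have hlen : (vs.length : ℤ) ≤ n := by simpa using hvs.length_le_card
    have hnonneg : 0 ≤ numQueries s := sum_nonneg fun _ _ => by positivity
    rw [List.map_nil, List.sum_nil, add_zero] at hn
    simp only [List.sum_map_add, List.sum_map_mul_left, List.map_const', List.sum_replicate,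
      nsmul_eq_mul, mul_one] at hc
    exact ⟨by linarith, hF, by nlinarith⟩

theorem run_removeAllCrossForwardEdges (hL : n ≤ ack L 1)
    (hvs : (s .order none : List (Fin n)).Nodup) (hs : IsRep .anc σ s) :
    Run (potential L) removeAllCrossForwardEdges s fun _ s' c =>
      numStored s' ≤ numStored s + (numQueries s + (crossing s).length) ∧
      Frame {.query, .link .anc, .rank .anc, .label .anc, .R} s s' ∧
        c ≤ 3 * opCost L * (numQueries s + 2 * (crossing s).length + n + 1) := by
  have hK := le_opCost L
  simp only [removeAllCrossForwardEdges, run_bind, run_read]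
  refine (run_forEach_storeQuery (crossing s) s).mono ?_
  rintro _ s₁ c₁ ⟨hq₁, hF₁, hc₁⟩
  rw [hF₁ .order (by simp)]
  refine (run_forEach_answerQueries hL hvs (hs.frame hF₁)).mono ?_
  rintro _ s₂ c₂ ⟨hn₂, hF₂, hc₂⟩
  have hn₁ : numStored s₁ = numStored s := by
    simp only [numStored, stored, hF₁ .R (by simp)]
  rw [hq₁] at hn₂ hc₂
  exact ⟨hn₁ ▸ hn₂, hF₁.mono.trans hF₂, by nlinarith⟩

end Preparation

/-! ## The running time of the algorithm -/

section RunningTime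

open Finset

variable {n L : ℕ} {s s' : Memory n} {σ : Fin n → Fin n}

theorem pendingWork_nonneg (σ : Fin n → Fin n) (vs : List (Fin n)) (s : Memory n) :
    0 ≤ pendingWork σ vs s :=
  sum_nonneg fun v _ => mul_nonneg (credit_nonneg σ vs v) (weight_pos s v).le

theorem classifiedSize_frame {A : Set Arr} (hF : Frame A s s') (hback : .back ∉ A := by simp)
    (hpred : .pred ∉ A := by simp) (hO : .O ∉ A := by simp) (hcross : .cross ∉ A := by simp) :
    classifiedSize s' = classifiedSize s := by
  simp only [classifiedSize, weight_frame hF hpred hO, backs, crossing, hF _ hback, hF _ hcross]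

theorem classifiedSize_of_isInit (h : ∀ v, IsInit s v) (hcross : crossing s = []) :
    classifiedSize s = n := by
  simp [classifiedSize, weight, (h _).backs_eq, (h _).preds_eq, (h _).outs_eq, hcross]

theorem add_two_mul_length_crossing_le (s : Memory n) :
    n + 2 * (crossing s).length ≤ classifiedSize s := by
  have hsum : ∑ _v : Fin n, (1 : ℤ) ≤ ∑ v, ((backs s v).length + weight s v) :=
    sum_le_sum fun v _ => by linarith [weight_pos s v]
  rw [sum_const, card_univ, Fintype.card_fin, nsmul_one] at hsum
  unfold classifiedSize
  linarith

theorem sum_weight_le_classifiedSize (s : Memory n) : ∑ v, weight s v ≤ classifiedSize s := by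
  have hsum : ∑ v, weight s v ≤ ∑ v, ((backs s v).length + weight s v) :=
    sum_le_sum fun v _ => by omega
  unfold classifiedSize
  linarith

theorem sum_length_backs_add_stored_le {vs : List (Fin n)} (hvs : vs.Nodup) (s : Memory n) :
    (vs.map fun v => ((backs s v).length + (stored s (some v)).length + 1 : ℤ)).sum +
      (stored s none).length ≤ classifiedSize s + numStored s := by
  have hstored : numStored s = (stored s none).length + ∑ v, ((stored s (some v)).length : ℤ) :=
    Fintype.sum_option _
  have hvs_sum : (vs.map fun v => ((backs s v).length + (stored s (some v)).length + 1 : ℤ)).sum ≤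
      ∑ v, ((backs s v).length + weight s v) + ∑ v, ((stored s (some v)).length : ℤ) := by
    rw [← List.sum_toFinset _ hvs, ← sum_add_distrib]
    exact (sum_le_univ_sum_of_nonneg fun v => by positivity).trans
      (sum_le_sum fun v _ => by linarith [weight_pos s v])
  unfold classifiedSize
  linarith

/-- The phases of the algorithm from the main loop on. -/
def mainPhase (lift : Bool) : Prog n (Output n) := do
  let vs ← read .order none
  forEach vs (processVertex lift)
  restoreCrossForwardEdges none
  connectWPOsOfMaximalSCCs lift
  let X ← read .X none
  let fwd ← read .fwd none
  let bwd ← read .bwd none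
  pure ⟨X, fwd, bwd⟩

theorem run_mainPhase (hL : n ≤ ack L 1) (lift : Bool)
    (hvs : (s .order none : List (Fin n)).Nodup) (hs : IsRep .scc σ s) :
    Run (potential L) (mainPhase lift) s fun _ _ c =>
      c ≤ 41 * opCost L * (classifiedSize s + numStored s + 1) := by
  have hK := le_opCost L
  simp only [mainPhase, run_bind, run_read]
  refine (run_mainLoop hL lift hvs hs).mono ?_
  rintro _ s₁ c₁ ⟨⟨σ₁, hs₁, hc₁⟩, hF₁⟩
  have hstored₁ : stored s₁ none = stored s none := congrFun (hF₁ .R (by simp)) _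
  refine (run_restore hL none hs₁).mono ?_
  rintro _ s₂ c₂ ⟨hs₂, hw₂, hc₂⟩
  refine (run_connectWPOsOfMaximalSCCs hL lift hs₂).mono ?_
  rintro _ s₃ c₃ hc₃
  rw [run_pure]
  have hpending : pendingWork σ (s .order none) s ≤ 2 * classifiedSize s :=
    (pendingWork_le _ _ _).trans (by linarith [sum_weight_le_classifiedSize s])
  have hpending₁ := pendingWork_nonneg σ₁ [] s₁
  have hpending₂ := pendingWork_le_of_restore (σ := σ₁) (vs := []) hw₂
  have hn := add_two_mul_length_crossing_le s
  have hnumStored : 0 ≤ numStored s := sum_nonneg fun _ _ => Int.natCast_nonneg _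
  have hsum := mul_le_mul_of_nonneg_left (sum_length_backs_add_stored_le hvs s)
    (by omega : 0 ≤ 27 * opCost L)
  rw [hstored₁] at hc₂ hpending₂
  rw [List.length_map] at hpending₂
  calc _ ≤ opCost L * (6 * pendingWork σ (s .order none) s - 4 * pendingWork σ₁ [] s₁ +
        27 * (classifiedSize s + numStored s) + 2 * n + 5) := by nlinarith
    _ ≤ opCost L * (41 * (classifiedSize s + numStored s + 1)) := by
      refine mul_le_mul_of_nonneg_left ?_ (by omega)
      linarith
    _ = _ := by ring

/-- The phases of the algorithm after the initialization. -/
def constructFromInit (E : List (Fin n × Fin n)) (lift : Bool) : Prog n (Output n) := do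
  classifyEdges E
  removeAllCrossForwardEdges
  mainPhase lift

theorem run_constructFromInit (hL : n ≤ ack L 1) (E : List (Fin n × Fin n)) (lift : Bool)
    (hs : ∀ v, IsInit s v) (hstored : stored s none = []) (hcross : crossing s = [])
    (horder : (s .order none : List (Fin n)).Nodup) :
    Run (potential L) (constructFromInit E lift) s fun _ _ c =>
      c ≤ 130 * opCost L * (n + E.length + 1) := by
  have hK := le_opCost L
  simp only [constructFromInit, run_bind]
  refine (run_classifyEdges E s).mono ?_
  rintro _ s₁ c₁ ⟨⟨hsize₁, hc₁⟩, hF₁⟩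
  rw [classifiedSize_of_isInit hs hcross] at hsize₁
  have horder₁ : s₁ .order = s .order := hF₁ .order (by simp)
  have hqueries₁ : numQueries s₁ = 0 := by
    simp [numQueries, queries, hF₁ .query, (hs _).queries_eq]
  have hstored₁ : numStored s₁ = 0 := by
    simp [numStored, stored, hF₁ .R, hstored, (hs _).stored_eq]
  refine (run_removeAllCrossForwardEdges hL (horder₁ ▸ horder)
    ((isRep_of_isInit hs .anc).frame hF₁)).mono ?_
  rintro _ s₂ c₂ ⟨hstored₂, hF₂, hc₂⟩
  rw [hqueries₁] at hstored₂ hc₂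
  have horder₂ : s₂ .order = s₁ .order := hF₂ .order (by simp)
  have hs₂ := ((isRep_of_isInit hs .scc).frame hF₁).frame hF₂
  refine (run_mainPhase hL lift (by rwa [horder₂, horder₁]) hs₂).mono ?_
  rintro _ _ c₃ hc₃
  rw [classifiedSize_frame hF₂] at hc₃
  have hcross₁ := add_two_mul_length_crossing_le s₁
  have hsize₂ : classifiedSize s₁ + numStored s₂ + 1 ≤ 3 * (n + E.length + 1) := by linarith
  have hc₃' := mul_le_mul_of_nonneg_left hsize₂ (by omega : 0 ≤ opCost L)
  have hc₂' := mul_le_mul_of_nonneg_left (by linarith :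
    (0 : ℤ) + 2 * (crossing s₁).length + n + 1 ≤ 2 * (n + E.length + 1)) (by omega : 0 ≤ opCost L)
  nlinarith

theorem run_constructWPOBU (hL : n ≤ ack L 1) (E : List (Fin n × Fin n)) {D : Forest (Fin n)}
    (hD : D.verts.Nodup) (lift : Bool) (s : Memory n) :
    Run 0 (constructWPOBU E D lift) s fun _ _ t =>
      t ≤ 132 * opCost L * (n + E.length + 1) := by
  have hK := le_opCost L
  change Run 0 (setup D >>= fun _ => constructFromInit E lift) s _
  rw [run_bind]
  refine (run_setup D s).mono ?_
  rintro _ s₁ t₁ ⟨hinit, hstored, hcross, horder, ht₁⟩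
  refine ((run_constructFromInit hL E lift hinit hstored hcross
    (horder ▸ List.nodup_reverse.2 hD)).steps_le (potential_eq_zero_of_isInit hinit)
    (potential_nonneg L)).mono ?_
  rintro _ _ t₂ ⟨c, htc, hc⟩
  have hlen : (D.verts.length : ℤ) ≤ n := by simpa using hD.length_le_card
  nlinarith

end RunningTime

end WPO

theorem mainTheorem3_general :
    ∃ C : ℕ, ∀ (n : ℕ) (E : List (Fin n × Fin n)) (D : WPO.Forest (Fin n)) (lift : Bool),
      D.verts.Nodup →
      ∀ s₀ : WPO.Memory n, ∃ (W : WPO.Output n) (s : WPO.Memory n) (t : ℕ),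
        WPO.constructWPOBU E D lift s₀ = some (W, s, t) ∧
        t ≤ C * (n + E.length + 1) * (WPO.invAck n + 1) := by
  refine ⟨5280, fun n E D lift hD s₀ => ?_⟩
  obtain ⟨W, s, t, hrun, ht⟩ :=
    WPO.run_constructWPOBU (WPO.le_ack_invAck_succ n) E hD lift s₀
  refine ⟨W, s, t, hrun, ?_⟩
  have hopCost : WPO.opCost (WPO.invAck n + 1) ≤ 40 * (WPO.invAck n + 1) := by
    unfold WPO.opCost
    push_cast
    linarith
  have ht : (t : ℤ) ≤ 5280 * (n + E.length + 1) * (WPO.invAck n + 1) := by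
    simp only [Pi.zero_apply, add_zero, sub_zero] at ht
    nlinarith
  exact_mod_cast ht

theorem mainTheorem3 :
    ∃ C : ℕ, ∀ (n : ℕ) (E : List (Fin n × Fin n)) (D : WPO.Forest (Fin n)) (lift : Bool),
      E.Nodup → WPO.IsDepthFirstForest (fun u v => (u, v) ∈ E) D →
      ∀ s₀ : WPO.Memory n, ∃ (W : WPO.Output n) (s : WPO.Memory n) (t : ℕ),
        WPO.constructWPOBU E D lift s₀ = some (W, s, t) ∧
        t ≤ C * (n + E.length + 1) * (WPO.invAck n + 1) :=
  mainTheorem3_general.imp fun _ h n E D lift _ hD => h n E D lift (WPO.DFS.nodup_verts hD)
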